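/- Let $\Bbbk=\mathbb{R}$ or $\mathbb{C}$, let $m,n\ge 1$ and $\pi\subset\{1,\dots,m\}$ with $k=\sharp\pi$. Every $A\in\Bbbk^{m\times n}$ has a full singular value decomposition $A=U\Sigma V^H$ with $U\in\Bbbk^{m\times m}$, $V\in\Bbbk^{n\times n}$ unitary and $\Sigma$ the $m\times n$ matrix with the singular values $\sigma_1\ge\sigma_2\ge\cdots\ge 0$ on its diagonal and zeros elsewhere; put $\sigma_i=0$ for $i>\operatorname{rank}A$. For a set $S$ of singular values of $A$ (the value $0$ being allowed) let $\mathrm U_S$ be the sum of the eigenspaces of $AA^H$ for the eigenvalues $s^2$, $s\in S$; such subspaces of $\Bbbk^m$ are called left singular subspaces of $A$. Let $\mathrm{U}_\pi$ be the span of the columns of $U$ at the positions in $\pi$, let $\mathcal U_\pi$ be the set of all $A\in\Bbbk^{m\times n}$ for which $\mathrm U_\pi$ is a left singular subspace of $A$, and let $$\mathcal L_\pi:\mathcal U_\pi\to \mathrm{Gr}(k,\Bbbk^m)=\{QQ^H : Q\in\Bbbk^{m\times k},\ Q^HQ=I_k\},\qquad A\mapsto \mathrm U_\pi$$ (a subspace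 is identified with the orthogonal projector onto it; $\mathcal L_\pi(A)$ does not depend on the choice of the decomposition). For $P=QQ^H$ and $P'=Q'Q'^H$ in $\mathrm{Gr}(k,\Bbbk^m)$ let $\theta_i=\arccos\sigma_i(Q^HQ')$, $i=1,\dots,k$, be the principal angles, $\boldsymbol\theta=(\theta_1,\dots,\theta_k)$, and let $$d^c_{\mathrm{Gr}}(P,P')=\|\sin\boldsymbol\theta\|,\qquad d^G_{\mathrm{Gr}}(P,P')=\|\boldsymbol\theta\|,\qquad d^P_{\mathrm{Gr}}(P,P')=\|2\sin(\boldsymbol\theta/2)\|$$ be the chordal, Grassmann and Procrustes distances (functions act elementwise, norms are Euclidean). For $\star\in\{c,G,P\}$ let $$\kappa^\star[\mathcal L_\pi](A)=\lim_{\epsilon\to0}\ \sup_{A'\in\mathcal U_\pi,\ 0<\|A-A'\|_F\le\epsilon}\frac{d^\star_{\mathrm{Gr}}(\mathcal L_\pi(A),\mathcal L_\pi(A'))}{\|A-A'\|_F}\in[0,\infty]$$ be the condition number of $\mathcal L_\pi$ at $A\in\mathcal U_\pi$. Corollary (Error bound). Let $A\in\mathcal U_\pi$. The condition number $\kappa^\star[\mathcal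 L_\pi](A)$ is finite and is the same number $\kappa[\mathcal L_\pi](A)$ for all three $\star\in\{c,G,P\}$. For every $\star\in\{c,G,P\}$ the following first-order sharp error bound holds. 1. (Bound) There is a function $\delta:\mathcal U_\pi\to\mathbb R$ with $\delta(A')\to0$ as $A'\to A$ such that for all $A'\in\mathcal U_\pi$ $$d^\star_{\mathrm{Gr}}\bigl(\mathcal L_\pi(A),\mathcal L_\pi(A')\bigr)\le\kappa[\mathcal L_\pi](A)\cdot\|A-A'\|_F\cdot(1+\delta(A')).$$ 2. (First-order sharpness) There are matrices $A_j\in\mathcal U_\pi\setminus\{A\}$ with $A_j\to A$ and real numbers $\eta_j\to0$ such that for all $j$ $$d^\star_{\mathrm{Gr}}\bigl(\mathcal L_\pi(A),\mathcal L_\pi(A_j)\bigr)=\kappa[\mathcal L_\pi](A)\cdot\|A-A_j\|_F\cdot(1+\eta_j).$$ -/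

import Mathlib

open scoped Matrix Matrix.Norms.Frobenius ENNReal Topology
open Filter

noncomputable section

/-! ### Rice's condition number -/

/-- The condition number of `f : X → Y` at `x` with respect to the distances `dX`, `dY`:
the limit for `ε → 0` of the supremum of `dY (f x) (f x') / dX x x'` over the points `x'` with
`0 < dX x x' ≤ ε`. The supremum is monotone in `ε`, so the limit is an infimum
(see `tendsto_riceCond`). -/
def riceCond {X Y : Type*} (dX : X → X → ℝ) (dY : Y → Y → ℝ) (f : X → Y) (x : X) : ℝ≥0∞ :=
  ⨅ ε : {ε : ℝ // 0 < ε}, ⨆ x' : {x' : X // 0 < dX x x' ∧ dX x x' ≤ ε.1},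
    ENNReal.ofReal (dY (f x) (f x'.1) / dX x x'.1)

theorem tendsto_riceCond {X Y : Type*} (dX : X → X → ℝ) (dY : Y → Y → ℝ) (f : X → Y) (x : X) :
    Tendsto (fun ε : ℝ => ⨆ x' : {x' : X // 0 < dX x x' ∧ dX x x' ≤ ε},
      ENNReal.ofReal (dY (f x) (f x'.1) / dX x x'.1)) (𝓝[>] 0) (𝓝 (riceCond dX dY f x)) := by
  have hmono : Monotone (fun ε : ℝ => ⨆ x' : {x' : X // 0 < dX x x' ∧ dX x x' ≤ ε},
      ENNReal.ofReal (dY (f x) (f x'.1) / dX x x'.1)) := by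
    intro a b hab
    refine iSup_le fun x' => ?_
    exact le_iSup (fun x' : {x' : X // 0 < dX x x' ∧ dX x x' ≤ b} =>
      ENNReal.ofReal (dY (f x) (f x'.1) / dX x x'.1)) ⟨x'.1, x'.2.1, x'.2.2.trans hab⟩
  have h := hmono.tendsto_nhdsGT (0 : ℝ)
  rwa [sInf_image'] at h

/-! ### Singular values, the singular value decomposition and left singular subspaces -/

/-- The singular values of `A`, in decreasing order, repeated according to multiplicity, numbered
from `0`, and equal to `0` from the index `rank A` on. -/
def sv {𝕜 : Type*} [RCLike 𝕜] {m n : ℕ} (A : Matrix (Fin m) (Fin n) 𝕜) : ℕ → ℝ :=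
  fun i => (Matrix.toEuclideanLin A).singularValues i

/-- The `m × n` matrix with the singular values of `A` on its diagonal and `0` elsewhere. -/
def sigmaMatrix {𝕜 : Type*} [RCLike 𝕜] {m n : ℕ} (A : Matrix (Fin m) (Fin n) 𝕜) :
    Matrix (Fin m) (Fin n) 𝕜 :=
  Matrix.of fun i j => if (i : ℕ) = (j : ℕ) then ((sv A i : ℝ) : 𝕜) else 0

/-- `A = U * Σ * Vᴴ` is a full singular value decomposition. -/
def IsFullSVD {𝕜 : Type*} [RCLike 𝕜] {m n : ℕ} (A : Matrix (Fin m) (Fin n) 𝕜)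
    (U : Matrix (Fin m) (Fin m) 𝕜) (V : Matrix (Fin n) (Fin n) 𝕜) : Prop :=
  U ∈ Matrix.unitaryGroup (Fin m) 𝕜 ∧ V ∈ Matrix.unitaryGroup (Fin n) 𝕜 ∧
    A = U * sigmaMatrix A * Vᴴ

/-- The left singular subspace of `A` associated with one singular value `s` (the cokernel, if
`s = 0`): the invariant subspace of `A * Aᴴ` for the eigenvalue `s ^ 2`. -/
def leftSingularSpace {𝕜 : Type*} [RCLike 𝕜] {m n : ℕ} (A : Matrix (Fin m) (Fin n) 𝕜) (s : ℝ) :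
    Submodule 𝕜 (Fin m → 𝕜) :=
  Module.End.eigenspace (Matrix.toLin' (A * Aᴴ)) ((s ^ 2 : ℝ) : 𝕜)

/-- `W` is a left singular subspace of `A`: the sum of the left singular subspaces associated
with the elements of a set `S` of singular values. (The sequence `sv A` takes as values precisely
the positive singular values of `A`, and `0`.) -/
def IsLeftSingularSubspace {𝕜 : Type*} [RCLike 𝕜] {m n : ℕ} (A : Matrix (Fin m) (Fin n) 𝕜)
    (W : Submodule 𝕜 (Fin m → 𝕜)) : Prop :=
  ∃ S : Set ℝ, S ⊆ Set.range (sv A) ∧ W = ⨆ s ∈ S, leftSingularSpace A s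

/-- The span of the columns of `U` at the positions in `p`. -/
def colSpan {𝕜 : Type*} [RCLike 𝕜] {m : ℕ} (U : Matrix (Fin m) (Fin m) 𝕜) (p : Finset (Fin m)) :
    Submodule 𝕜 (Fin m → 𝕜) :=
  Submodule.span 𝕜 ((fun i => Uᵀ i) '' (p : Set (Fin m)))

/-- The set of the matrices `A` for which the left singular vectors at the positions in `p`
span a left singular subspace of `A`. -/
def leftDomain (𝕜 : Type*) [RCLike 𝕜] (m n : ℕ) (p : Finset (Fin m)) :
    Set (Matrix (Fin m) (Fin n) 𝕜) :=
  {A | ∃ U V, IsFullSVD A U V ∧ IsLeftSingularSubspace A (colSpan U p)}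

/-! ### The Grassmannian -/

/-- The Grassmannian, as the set of orthogonal projectors `Q * Qᴴ` of rank `d`. -/
def Gr (𝕜 : Type*) [RCLike 𝕜] (d m : ℕ) : Set (Matrix (Fin m) (Fin m) 𝕜) :=
  {P | ∃ Q : Matrix (Fin m) (Fin d) 𝕜, Qᴴ * Q = 1 ∧ P = Q * Qᴴ}

/-- A matrix `Q` with orthonormal columns such that `P = Q * Qᴴ`. -/
def frame {𝕜 : Type*} [RCLike 𝕜] {d m : ℕ} (P : Gr 𝕜 d m) : Matrix (Fin m) (Fin d) 𝕜 :=
  P.2.choose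

/-- The principal angles between `P = Q * Qᴴ` and `P' = Q' * Q'ᴴ`, namely
`arccos (σ_i (Qᴴ * Q'))`. They do not depend on the choice of the frames `Q` and `Q'`
(see `principalAngle_eq`). -/
def principalAngle {𝕜 : Type*} [RCLike 𝕜] {d m : ℕ} (P P' : Gr 𝕜 d m) (i : Fin d) : ℝ :=
  Real.arccos (sv ((frame P)ᴴ * frame P') i)

/-- Names of the three distances on the Grassmannian. -/
inductive GrDist
  | chordal
  | grassmann
  | procrustes

/-- The chordal, Grassmann and Procrustes distances `‖sin θ‖`, `‖θ‖`, `‖2 sin (θ / 2)‖`,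
where `θ` is the vector of principal angles and the norm is Euclidean. -/
def grDist {𝕜 : Type*} [RCLike 𝕜] {d m : ℕ} : GrDist → Gr 𝕜 d m → Gr 𝕜 d m → ℝ
  | .chordal, P, P' => √(∑ i, Real.sin (principalAngle P P' i) ^ 2)
  | .grassmann, P, P' => √(∑ i, principalAngle P P' i ^ 2)
  | .procrustes, P, P' => √(∑ i, (2 * Real.sin (principalAngle P P' i / 2)) ^ 2)

/-! ### The map that takes a matrix to its left singular subspace -/

/-- The matrix of the columns of `U` at the positions in `p`. -/
def cols {𝕜 : Type*} [RCLike 𝕜] {m : ℕ} (U : Matrix (Fin m) (Fin m) 𝕜) (p : Finset (Fin m)) :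
    Matrix (Fin m) (Fin p.card) 𝕜 :=
  U.submatrix id (p.orderEmbOfFin rfl)

theorem cols_conjTranspose_mul {𝕜 : Type*} [RCLike 𝕜] {m : ℕ} {U : Matrix (Fin m) (Fin m) 𝕜}
    (hU : U ∈ Matrix.unitaryGroup (Fin m) 𝕜) (p : Finset (Fin m)) :
    (cols U p)ᴴ * cols U p = 1 := by
  have h1 : Uᴴ * U = 1 := Matrix.mem_unitaryGroup_iff'.1 hU
  ext i j
  have h2 := congrFun (congrFun h1 (p.orderEmbOfFin rfl i)) (p.orderEmbOfFin rfl j)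
  simpa [cols, Matrix.mul_apply, Matrix.one_apply] using h2

/-- The map that takes a matrix `A` to the span of its left singular vectors at the positions in
`p`, represented by the orthogonal projector onto this span. It does not depend on the choice of
the singular value decomposition (see `leftMap_eq`). -/
def leftMap {𝕜 : Type*} [RCLike 𝕜] {m n : ℕ} {p : Finset (Fin m)} (A : leftDomain 𝕜 m n p) :
    Gr 𝕜 p.card m :=
  ⟨cols A.2.choose p * (cols A.2.choose p)ᴴ, cols A.2.choose p,
    cols_conjTranspose_mul A.2.choose_spec.choose_spec.1.1 p, rfl⟩

/-- The condition number of `leftMap` at `A`, with respect to the Frobenius distance on the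
matrices and one of the three distances on the Grassmannian. -/
def condLeft {𝕜 : Type*} [RCLike 𝕜] {m n : ℕ} {p : Finset (Fin m)} (t : GrDist)
    (A : leftDomain 𝕜 m n p) : ℝ≥0∞ :=
  riceCond (fun A A' : leftDomain 𝕜 m n p => ‖A.1 - A'.1‖) (grDist t) leftMap A

/-! ### The principal angles and the left singular subspace are well defined -/

theorem sv_eq_of_charpoly {𝕜 : Type*} [RCLike 𝕜] {k m n : ℕ} {M : Matrix (Fin k) (Fin n) 𝕜}
    {N : Matrix (Fin m) (Fin n) 𝕜} (h : (Mᴴ * M).charpoly = (Nᴴ * N).charpoly) : sv M = sv N := by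
  have key : ∀ {l : ℕ} (B : Matrix (Fin l) (Fin n) 𝕜),
      (LinearMap.adjoint (Matrix.toEuclideanLin B) ∘ₗ Matrix.toEuclideanLin B).charpoly
        = (Bᴴ * B).charpoly := by
    intro l B
    rw [← Matrix.toEuclideanLin_conjTranspose_eq_adjoint, ← Matrix.toLpLin_mul,
      ← LinearMap.charpoly_toMatrix _ (EuclideanSpace.basisFun (Fin n) 𝕜).toBasis]
    congr 1
    have := Matrix.toEuclideanLin_eq_toLin_orthonormal (𝕜 := 𝕜) (m := Fin n) (n := Fin n)
    change LinearMap.toMatrix _ _ (Matrix.toEuclideanLin (Bᴴ * B)) = _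
    rw [this, LinearMap.toMatrix_toLin]
  have hn : Module.finrank 𝕜 (EuclideanSpace 𝕜 (Fin n)) = n := by simp
  funext i
  by_cases hi : i < n
  · have e := (LinearMap.IsSymmetric.eigenvalues_eq_eigenvalues_iff
      (Matrix.toEuclideanLin M).isSymmetric_adjoint_comp_self hn
      (Matrix.toEuclideanLin N).isSymmetric_adjoint_comp_self hn).2 (by rw [key, key, h])
    simp only [sv]
    rw [LinearMap.singularValues_of_lt _ hn hi, LinearMap.singularValues_of_lt _ hn hi, e]
  · simp only [sv]
    rw [LinearMap.singularValues_of_finrank_le _ (by simpa using hi),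
      LinearMap.singularValues_of_finrank_le _ (by simpa using hi)]

theorem principalAngle_eq {𝕜 : Type*} [RCLike 𝕜] {d m : ℕ} (P P' : Gr 𝕜 d m)
    {Q Q' : Matrix (Fin m) (Fin d) 𝕜} (_hQ : Qᴴ * Q = 1) (hP : P.1 = Q * Qᴴ)
    (_hQ' : Q'ᴴ * Q' = 1) (hP' : P'.1 = Q' * Q'ᴴ) (i : Fin d) :
    principalAngle P P' i = Real.arccos (sv (Qᴴ * Q') i) := by
  obtain ⟨h1, h2⟩ := P.2.choose_spec
  obtain ⟨h3, h4⟩ := P'.2.choose_spec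
  change (frame P)ᴴ * frame P = 1 at h1
  change P.1 = frame P * (frame P)ᴴ at h2
  change (frame P')ᴴ * frame P' = 1 at h3
  change P'.1 = frame P' * (frame P')ᴴ at h4
  unfold principalAngle
  suffices h : sv ((frame P)ᴴ * frame P') = sv (Qᴴ * Q') by rw [h]
  apply sv_eq_of_charpoly
  have e1 : ((frame P)ᴴ * frame P')ᴴ * ((frame P)ᴴ * frame P')
      = (frame P')ᴴ * (P.1 * frame P') := by
    rw [h2]; simp [Matrix.mul_assoc]
  have e2 : (Qᴴ * Q')ᴴ * (Qᴴ * Q') = Q'ᴴ * (P.1 * Q') := by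
    rw [hP]; simp [Matrix.mul_assoc]
  have key : ∀ {R : Matrix (Fin m) (Fin d) 𝕜}, P'.1 = R * Rᴴ →
      (Polynomial.X ^ m : Polynomial 𝕜) * (Rᴴ * (P.1 * R)).charpoly
        = Polynomial.X ^ d * (P.1 * P'.1).charpoly := by
    intro R hR
    have := Matrix.charpoly_mul_comm' Rᴴ (P.1 * R)
    rw [Matrix.mul_assoc, ← hR] at this
    simpa using this
  rw [e1, e2]
  exact mul_left_cancel₀ (pow_ne_zero m Polynomial.X_ne_zero) ((key h4).trans (key hP').symm)

theorem IsFullSVD.mul_conjTranspose {𝕜 : Type*} [RCLike 𝕜] {m n : ℕ}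
    {A : Matrix (Fin m) (Fin n) 𝕜} {U : Matrix (Fin m) (Fin m) 𝕜} {V : Matrix (Fin n) (Fin n) 𝕜}
    (h : IsFullSVD A U V) :
    A * Aᴴ = U * Matrix.diagonal (fun i : Fin m => ((sv A i ^ 2 : ℝ) : 𝕜)) * Uᴴ := by
  obtain ⟨hU, hV, hA⟩ := h
  have h1 : Vᴴ * V = 1 := Matrix.mem_unitaryGroup_iff'.1 hV
  have h2 : sigmaMatrix A * (sigmaMatrix A)ᴴ = Matrix.diagonal (fun i : Fin m => ((sv A i ^ 2 : ℝ) : 𝕜)) := by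
    ext i j
    rw [Matrix.mul_apply, Matrix.diagonal_apply]
    by_cases hi : (i : ℕ) < n
    · rw [Finset.sum_eq_single (⟨i, hi⟩ : Fin n)]
      · by_cases hij : i = j
        · subst hij
          simp [sigmaMatrix, sq]
        · have : (j : ℕ) ≠ i := fun h => hij (Fin.ext h.symm)
          simp [sigmaMatrix, hij, this]
      · intro k _ hk
        have : (i : ℕ) ≠ k := fun h => hk (Fin.ext h.symm)
        simp [sigmaMatrix, this]
      · simp
    · have h0 : sv A i = 0 :=
        LinearMap.singularValues_of_finrank_le _ (by simpa using hi)
      simp [sigmaMatrix, h0]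
  calc A * Aᴴ = (U * sigmaMatrix A * Vᴴ) * (U * sigmaMatrix A * Vᴴ)ᴴ := by rw [← hA]
    _ = U * sigmaMatrix A * (Vᴴ * V) * (sigmaMatrix A)ᴴ * Uᴴ := by simp [Matrix.mul_assoc]
    _ = U * (sigmaMatrix A * (sigmaMatrix A)ᴴ) * Uᴴ := by rw [h1]; simp [Matrix.mul_assoc]
    _ = _ := by rw [h2]

theorem IsFullSVD.mem {𝕜 : Type*} [RCLike 𝕜] {m n : ℕ}
    {A : Matrix (Fin m) (Fin n) 𝕜} {U : Matrix (Fin m) (Fin m) 𝕜} {V : Matrix (Fin n) (Fin n) 𝕜}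
    (h : IsFullSVD A U V) (i : Fin m) : Uᵀ i ∈ leftSingularSpace A (sv A i) := by
  have h1 : Uᴴ * U = 1 := Matrix.mem_unitaryGroup_iff'.1 h.1
  have h2 : A * Aᴴ * U = U * Matrix.diagonal (fun i : Fin m => ((sv A i ^ 2 : ℝ) : 𝕜)) := by
    rw [h.mul_conjTranspose, Matrix.mul_assoc, h1, Matrix.mul_one]
  rw [leftSingularSpace, Module.End.mem_eigenspace_iff]
  generalize A * Aᴴ = M at h2 ⊢
  ext j
  have h3 := congrFun (congrFun h2 j) i
  rw [Matrix.mul_diagonal, Matrix.mul_apply] at h3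
  simpa [Matrix.mulVec, dotProduct, mul_comm] using h3

/-- The singular values at the selected positions differ from those at the other positions. -/
theorem separated {𝕜 : Type*} [RCLike 𝕜] {m n : ℕ} {p : Finset (Fin m)}
    {A : Matrix (Fin m) (Fin n) 𝕜} {U : Matrix (Fin m) (Fin m) 𝕜} {V : Matrix (Fin n) (Fin n) 𝕜}
    (h : IsFullSVD A U V) (hs : IsLeftSingularSubspace A (colSpan U p)) {i j : Fin m}
    (hi : i ∈ p) (hj : j ∉ p) : sv A i ≠ sv A j := by
  intro hij
  have h1 : Uᴴ * U = 1 := Matrix.mem_unitaryGroup_iff'.1 h.1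
  have hself : ∀ l : Fin m, Uᴴ.mulVec (Uᵀ l) = Pi.single l 1 := by
    intro l
    ext k
    have := congrFun (congrFun h1 k) l
    rw [Matrix.mul_apply] at this
    simpa [Matrix.mulVec, dotProduct, Matrix.one_apply, Pi.single_apply] using this
  obtain ⟨S, hS, hW⟩ := hs
  by_cases hiS : sv A i ∈ S
  · have hmem : Uᵀ j ∈ colSpan U p := by
      rw [hW]
      exact (le_iSup₂ (f := fun s (_ : s ∈ S) => leftSingularSpace A s) (sv A i) hiS)
        (hij ▸ h.mem j)
    have hle : colSpan U p ≤
        LinearMap.ker ((LinearMap.proj j : (Fin m → 𝕜) →ₗ[𝕜] 𝕜) ∘ₗ Matrix.toLin' Uᴴ) := by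
      refine Submodule.span_le.2 ?_
      rintro _ ⟨l, hl, rfl⟩
      have : l ≠ j := fun e => hj (e ▸ hl)
      simp [hself, this]
    have := hle hmem
    simp [hself] at this
  · have hmem : Uᵀ i ∈ colSpan U p := Submodule.subset_span ⟨i, hi, rfl⟩
    have hind := Module.End.eigenspaces_iSupIndep (Matrix.toLin' (A * Aᴴ))
      (((sv A i) ^ 2 : ℝ) : 𝕜)
    have hle : colSpan U p ≤ ⨆ μ : 𝕜, ⨆ _ : μ ≠ (((sv A i) ^ 2 : ℝ) : 𝕜),
        Module.End.eigenspace (Matrix.toLin' (A * Aᴴ)) μ := by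
      rw [hW]
      refine iSup₂_le fun s hs => ?_
      refine le_iSup₂_of_le ((s ^ 2 : ℝ) : 𝕜) ?_ le_rfl
      intro e
      have e' : s ^ 2 = sv A i ^ 2 := by exact_mod_cast e
      obtain ⟨l, rfl⟩ := hS hs
      have h0 : ∀ l, 0 ≤ sv A l := fun l => LinearMap.singularValues_nonneg _ l
      rw [sq_eq_sq₀ (h0 _) (h0 _)] at e'
      exact hiS (e' ▸ hs)
    have h0 : Uᵀ i = 0 := by
      have := Submodule.disjoint_def.1 hind (Uᵀ i) (h.mem i) (hle hmem)
      exact this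
    have := hself i
    rw [h0] at this
    have := congrFun this i
    simp at this

theorem cols_mul_conjTranspose {𝕜 : Type*} [RCLike 𝕜] {m : ℕ} (U : Matrix (Fin m) (Fin m) 𝕜)
    (p : Finset (Fin m)) : cols U p * (cols U p)ᴴ =
      U * Matrix.diagonal (fun i => if i ∈ p then (1 : 𝕜) else 0) * Uᴴ := by
  ext i j
  rw [Matrix.mul_apply, Matrix.mul_apply]
  simp only [Matrix.mul_diagonal, cols, Matrix.conjTranspose_apply, Matrix.submatrix_apply, id]
  simp only [mul_ite, mul_one, mul_zero, ite_mul, zero_mul, Finset.sum_ite_mem,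
    Finset.univ_inter]
  have := Finset.sum_map Finset.univ (p.orderEmbOfFin rfl).toEmbedding
    (fun k => U i k * star (U j k))
  rw [Finset.map_orderEmbOfFin_univ] at this
  exact this.symm

theorem leftMap_eq {𝕜 : Type*} [RCLike 𝕜] {m n : ℕ} {p : Finset (Fin m)}
    (A : leftDomain 𝕜 m n p) {U : Matrix (Fin m) (Fin m) 𝕜} {V : Matrix (Fin n) (Fin n) 𝕜}
    (h : IsFullSVD A.1 U V) : (leftMap A).1 = cols U p * (cols U p)ᴴ := by
  obtain ⟨V₀, h0, hs⟩ := A.2.choose_spec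
  change cols A.2.choose p * (cols A.2.choose p)ᴴ = _
  generalize A.2.choose = U₀ at h0 hs
  have a1 : U₀ᴴ * U₀ = 1 := Matrix.mem_unitaryGroup_iff'.1 h0.1
  have a2 : U₀ * U₀ᴴ = 1 := Matrix.mem_unitaryGroup_iff.1 h0.1
  have b1 : Uᴴ * U = 1 := Matrix.mem_unitaryGroup_iff'.1 h.1
  have b2 : U * Uᴴ = 1 := Matrix.mem_unitaryGroup_iff.1 h.1
  set D : Matrix (Fin m) (Fin m) 𝕜 :=
    Matrix.diagonal (fun i : Fin m => ((sv A.1 i ^ 2 : ℝ) : 𝕜)) with hD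
  set J : Matrix (Fin m) (Fin m) 𝕜 :=
    Matrix.diagonal (fun i => if i ∈ p then (1 : 𝕜) else 0) with hJ
  have e : U₀ * D * U₀ᴴ = U * D * Uᴴ := by
    rw [← h0.mul_conjTranspose, ← h.mul_conjTranspose]
  have comm : D * (U₀ᴴ * U) = (U₀ᴴ * U) * D := by
    calc D * (U₀ᴴ * U) = (U₀ᴴ * U₀) * D * U₀ᴴ * U := by rw [a1]; simp [Matrix.mul_assoc]
      _ = U₀ᴴ * (U₀ * D * U₀ᴴ) * U := by simp [Matrix.mul_assoc]
      _ = U₀ᴴ * (U * D * Uᴴ) * U := by rw [e]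
      _ = U₀ᴴ * U * D * (Uᴴ * U) := by simp [Matrix.mul_assoc]
      _ = _ := by rw [b1, Matrix.mul_one]
  have commJ : J * (U₀ᴴ * U) = (U₀ᴴ * U) * J := by
    generalize U₀ᴴ * U = W at comm
    ext i j
    have c := congrFun (congrFun comm i) j
    rw [hD, Matrix.diagonal_mul, Matrix.mul_diagonal] at c
    rw [hJ, Matrix.diagonal_mul, Matrix.mul_diagonal]
    have hz : sv A.1 i ≠ sv A.1 j → W i j = 0 := by
      intro hne
      have n0 : ∀ l, 0 ≤ sv A.1 l := fun l => LinearMap.singularValues_nonneg _ l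
      have hne' : ((sv A.1 i ^ 2 : ℝ) : 𝕜) ≠ ((sv A.1 j ^ 2 : ℝ) : 𝕜) := by
        intro q
        have q' : sv A.1 i ^ 2 = sv A.1 j ^ 2 := by exact_mod_cast q
        rw [sq_eq_sq₀ (n0 _) (n0 _)] at q'
        exact hne q'
      by_contra hW
      rw [mul_comm] at c
      exact hne' (mul_left_cancel₀ hW c)
    by_cases hi : i ∈ p <;> by_cases hj : j ∈ p
    · simp [hi, hj]
    · simp [hz (separated h0 hs hi hj)]
    · simp [hz (separated h0 hs hj hi).symm]
    · simp [hi, hj]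
  rw [cols_mul_conjTranspose, cols_mul_conjTranspose]
  calc U₀ * J * U₀ᴴ = U₀ * J * U₀ᴴ * (U * Uᴴ) := by rw [b2, Matrix.mul_one]
    _ = U₀ * (J * (U₀ᴴ * U)) * Uᴴ := by simp [Matrix.mul_assoc]
    _ = (U₀ * U₀ᴴ) * U * J * Uᴴ := by rw [commJ]; simp [Matrix.mul_assoc]
    _ = _ := by rw [a2, Matrix.one_mul]

end

/-!
The error bound and its sharpness are formal consequences of the definition of the condition number
`κ` as a limit of suprema, provided that `0 < κ < ∞` (`exists_bound_of_riceCond`,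
`exists_sharp_of_riceCond`). What has to be shown about the map from `A` to its left singular
subspace is the following.

* The three distances have the same condition number (`condLeft_eq_chordal`). This follows from
  `sin θ ≤ 2 sin (θ / 2) ≤ θ` and from `(1 - d ^ 2) * θ ≤ sin θ`, where `d` is the chordal distance
  (`grassmann_mul_le_chordal`).
* The condition number is finite (`condLeft_chordal_ne_top`). If `U`, `U'` are the left factors of
  singular value decompositions of `A`, `A'` and `W = Uᴴ * U'`, then the squared chordal distance is
  the mass `∑ ‖W i j‖ ^ 2` over `i ∉ p`, `j ∈ p` (`chordal_leftMap_sq`), while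
  `‖A * Aᴴ - A' * A'ᴴ‖ ^ 2 = ∑ (σ i ^ 2 - σ' j ^ 2) ^ 2 * ‖W i j‖ ^ 2`. The latter identity yields
  Weyl's inequality (`abs_sub_le_norm_diagonal_mul_sub`), hence a uniform spectral gap near `A`, and
  then the local Lipschitz bound (`gap_sq_mul_sum_norm_sq_le`).
* The condition number is positive unless `p` is empty or everything (`condLeft_chordal_ne_zero`):
  multiplying `A` from the left by small plane rotations keeps the singular values and moves the
  subspace at a positive rate.

If `p` is empty or everything, the map is constant and defined everywhere, and both sides of the
bound and of the sharpness equation vanish.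
-/

/-! ### First-order error bounds from a condition number -/

section Rice

variable {X Y : Type*} {dX : X → X → ℝ} {dY : Y → Y → ℝ} {f : X → Y} {x : X} {c ε : ℝ}

theorem riceCond_le_ofReal (hε : 0 < ε)
    (h : ∀ x', 0 < dX x x' → dX x x' ≤ ε → dY (f x) (f x') ≤ c * dX x x') :
    riceCond dX dY f x ≤ ENNReal.ofReal c :=
  iInf_le_of_le ⟨ε, hε⟩ <| iSup_le fun x' =>
    ENNReal.ofReal_le_ofReal <| (div_le_iff₀ x'.2.1).2 (h x'.1 x'.2.1 x'.2.2)

theorem ofReal_le_riceCond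
    (h : ∀ ε : ℝ, 0 < ε → ∃ x', 0 < dX x x' ∧ dX x x' ≤ ε ∧ c * dX x x' ≤ dY (f x) (f x')) :
    ENNReal.ofReal c ≤ riceCond dX dY f x := by
  refine le_iInf fun ε => ?_
  obtain ⟨x', h0, h1, h2⟩ := h ε.1 ε.2
  exact le_iSup_of_le ⟨x', h0, h1⟩ (ENNReal.ofReal_le_ofReal ((le_div_iff₀ h0).2 h2))

theorem exists_le_mul_of_riceCond_lt (hc : 0 ≤ c) (h : riceCond dX dY f x < ENNReal.ofReal c) :
    ∃ ε : ℝ, 0 < ε ∧ ∀ x', 0 < dX x x' → dX x x' ≤ ε → dY (f x) (f x') ≤ c * dX x x' := by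
  obtain ⟨ε, hε⟩ := iInf_lt_iff.1 h
  refine ⟨ε.1, ε.2, fun x' h0 h1 => (div_le_iff₀ h0).1 ?_⟩
  rw [← ENNReal.ofReal_le_ofReal_iff hc]
  exact (le_iSup (fun x' : {x' : X // 0 < dX x x' ∧ dX x x' ≤ ε.1} =>
      ENNReal.ofReal (dY (f x) (f x'.1) / dX x x'.1)) ⟨x', h0, h1⟩).trans hε.le

theorem exists_mul_le_of_lt_riceCond (h : ENNReal.ofReal c < riceCond dX dY f x) (hε : 0 < ε) :
    ∃ x', 0 < dX x x' ∧ dX x x' ≤ ε ∧ c * dX x x' ≤ dY (f x) (f x') := by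
  obtain ⟨x', hx'⟩ := lt_iSup_iff.1 (h.trans_le (iInf_le _ ⟨ε, hε⟩))
  refine ⟨x'.1, x'.2.1, x'.2.2, (le_div_iff₀ x'.2.1).1 ?_⟩
  exact ((ENNReal.ofReal_lt_ofReal_iff').1 hx').1.le

end Rice

section RiceMetric

variable {X Y : Type*} [MetricSpace X] {dX : X → X → ℝ} {dY : Y → Y → ℝ} {f : X → Y} {x : X}

/-- A positive finite condition number is the constant of a first-order error bound. -/
theorem exists_bound_of_riceCond (hdX : ∀ x', dX x x' = dist x x') (h0 : riceCond dX dY f x ≠ 0)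
    (htop : riceCond dX dY f x ≠ ⊤) (hself : dY (f x) (f x) ≤ 0) :
    ∃ δ : X → ℝ, Tendsto δ (𝓝 x) (𝓝 0) ∧ ∀ x', dY (f x) (f x') ≤
      (riceCond dX dY f x).toReal * dX x x' * (1 + δ x') := by
  set κ := (riceCond dX dY f x).toReal with hκ
  have hκ0 : 0 < κ := ENNReal.toReal_pos h0 htop
  refine ⟨fun x' => max 0 (dY (f x) (f x') / (κ * dX x x') - 1), ?_, fun x' => ?_⟩
  · refine Metric.tendsto_nhds.2 fun e he => ?_
    have hlt : riceCond dX dY f x < ENNReal.ofReal (κ * (1 + e / 2)) := by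
      rw [← ENNReal.ofReal_toReal htop, ENNReal.ofReal_lt_ofReal_iff (by positivity)]
      exact lt_mul_of_one_lt_right hκ0 (by linarith)
    obtain ⟨ε, hε, h⟩ := exists_le_mul_of_riceCond_lt (by positivity) hlt
    filter_upwards [Metric.ball_mem_nhds x hε] with x' hx'
    rw [Real.dist_eq, sub_zero, abs_of_nonneg (le_max_left _ _)]
    refine max_lt he ?_
    rcases eq_or_ne x x' with rfl | hne
    · have : dX x x = 0 := by rw [hdX, dist_self]
      rw [this]
      norm_num
      linarith
    · have hpos : 0 < dX x x' := by rw [hdX]; exact dist_pos.2 hne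
      have := h x' hpos (by rw [hdX, dist_comm]; exact (Metric.mem_ball.1 hx').le)
      have : dY (f x) (f x') / (κ * dX x x') ≤ 1 + e / 2 := by
        rw [div_le_iff₀ (by positivity)]
        linarith
      linarith
  · rcases eq_or_ne x x' with rfl | hne
    · have : dX x x = 0 := by rw [hdX, dist_self]
      rw [this]
      simpa using hself
    · have hpos : 0 < dX x x' := by rw [hdX]; exact dist_pos.2 hne
      rw [← div_le_iff₀' (by positivity)]
      linarith [le_max_right 0 (dY (f x) (f x') / (κ * dX x x') - 1)]

/-- The first-order error bound given by a positive finite condition number is attained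
asymptotically along some sequence. -/
theorem exists_sharp_of_riceCond (hdX : ∀ x', dX x x' = dist x x') (h0 : riceCond dX dY f x ≠ 0)
    (htop : riceCond dX dY f x ≠ ⊤) :
    ∃ B : ℕ → X, (∀ k, B k ≠ x) ∧ Tendsto B atTop (𝓝 x) ∧
      ∃ η : ℕ → ℝ, Tendsto η atTop (𝓝 0) ∧ ∀ k, dY (f x) (f (B k)) =
        (riceCond dX dY f x).toReal * dX x (B k) * (1 + η k) := by
  set κ := (riceCond dX dY f x).toReal with hκ
  have hκ0 : 0 < κ := ENNReal.toReal_pos h0 htop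
  have key : ∀ k : ℕ, ∃ x', 0 < dX x x' ∧ dX x x' ≤ 1 / ((k : ℝ) + 1) ∧
      |dY (f x) (f x') / (κ * dX x x') - 1| ≤ 1 / ((k : ℝ) + 1) := by
    intro k
    have hk : (0 : ℝ) < 1 / ((k : ℝ) + 1) := Nat.one_div_pos_of_nat
    set e := 1 / ((k : ℝ) + 1)
    have hlt : riceCond dX dY f x < ENNReal.ofReal (κ * (1 + e)) := by
      rw [← ENNReal.ofReal_toReal htop, ENNReal.ofReal_lt_ofReal_iff (by positivity)]
      exact lt_mul_of_one_lt_right hκ0 (by linarith)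
    have hgt : ENNReal.ofReal (κ * (1 - e)) < riceCond dX dY f x := by
      rw [← ENNReal.ofReal_toReal htop, ENNReal.ofReal_lt_ofReal_iff hκ0]
      exact mul_lt_of_lt_one_right hκ0 (by linarith)
    obtain ⟨ε, hε, h⟩ := exists_le_mul_of_riceCond_lt (by positivity) hlt
    obtain ⟨x', h1, h2, h3⟩ := exists_mul_le_of_lt_riceCond hgt (lt_min hε hk)
    have h4 := h x' h1 (h2.trans (min_le_left _ _))
    refine ⟨x', h1, h2.trans (min_le_right _ _), abs_le.2 ⟨?_, ?_⟩⟩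
    · have : 1 - e ≤ dY (f x) (f x') / (κ * dX x x') := by
        rw [le_div_iff₀ (by positivity)]
        linarith
      linarith
    · have : dY (f x) (f x') / (κ * dX x x') ≤ 1 + e := by
        rw [div_le_iff₀ (by positivity)]
        linarith
      linarith
  choose B hB0 hB1 hB2 using key
  have hlim : Tendsto (fun k : ℕ => 1 / ((k : ℝ) + 1)) atTop (𝓝 0) :=
    tendsto_one_div_add_atTop_nhds_zero_nat
  refine ⟨B, ?_, ?_, fun k => dY (f x) (f (B k)) / (κ * dX x (B k)) - 1, ?_, ?_⟩
  · intro k hk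
    have := hB0 k
    rw [hdX, hk, dist_self] at this
    exact this.false
  · refine tendsto_iff_dist_tendsto_zero.2 (squeeze_zero (fun _ => dist_nonneg) (fun k => ?_) hlim)
    rw [dist_comm, ← hdX]
    exact hB1 k
  · exact squeeze_zero_norm hB2 hlim
  · intro k
    have := hB0 k
    rw [add_sub_cancel, mul_div_cancel₀ _ (by positivity)]

end RiceMetric

/-! ### The Frobenius norm and unitary matrices -/

section Frobenius

variable {𝕜 : Type*} [RCLike 𝕜] {l m n : ℕ}

theorem frobenius_norm_sq (A : Matrix (Fin m) (Fin n) 𝕜) : ‖A‖ ^ 2 = ∑ i, ∑ j, ‖A i j‖ ^ 2 := by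
  rw [Matrix.frobenius_norm_def, ← Real.sqrt_eq_rpow, Real.sq_sqrt (by positivity)]
  simp

theorem ofReal_frobenius_norm_sq (A : Matrix (Fin m) (Fin n) 𝕜) :
    ((‖A‖ ^ 2 : ℝ) : 𝕜) = (Aᴴ * A).trace := by
  rw [frobenius_norm_sq, Finset.sum_comm]
  simp [Matrix.trace, Matrix.mul_apply, RCLike.conj_mul]

theorem frobenius_norm_isometry_mul {Q : Matrix (Fin l) (Fin m) 𝕜} (hQ : Qᴴ * Q = 1)
    (A : Matrix (Fin m) (Fin n) 𝕜) : ‖Q * A‖ = ‖A‖ := by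
  have h : ((‖Q * A‖ ^ 2 : ℝ) : 𝕜) = ((‖A‖ ^ 2 : ℝ) : 𝕜) := by
    rw [ofReal_frobenius_norm_sq, ofReal_frobenius_norm_sq, Matrix.conjTranspose_mul,
      Matrix.mul_assoc, ← Matrix.mul_assoc Qᴴ, hQ, Matrix.one_mul]
  exact (sq_eq_sq₀ (norm_nonneg _) (norm_nonneg _)).1 (RCLike.ofReal_injective h)

theorem frobenius_norm_mul_unitary {U : Matrix (Fin n) (Fin n) 𝕜}
    (hU : U ∈ Matrix.unitaryGroup (Fin n) 𝕜) (A : Matrix (Fin m) (Fin n) 𝕜) : ‖A * U‖ = ‖A‖ := by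
  rw [← Matrix.frobenius_norm_conjTranspose, Matrix.conjTranspose_mul,
    frobenius_norm_isometry_mul, Matrix.frobenius_norm_conjTranspose]
  rw [Matrix.conjTranspose_conjTranspose]
  exact Matrix.mem_unitaryGroup_iff.1 hU

theorem sum_norm_sq_col {Q : Matrix (Fin m) (Fin n) 𝕜} (hQ : Qᴴ * Q = 1) (j : Fin n) :
    ∑ i, ‖Q i j‖ ^ 2 = 1 := by
  have h := congrFun (congrFun hQ j) j
  rw [Matrix.mul_apply, Matrix.one_apply_eq] at h
  simp only [Matrix.conjTranspose_apply, RCLike.star_def, RCLike.conj_mul] at h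
  exact_mod_cast h

theorem sum_norm_sq_row {W : Matrix (Fin m) (Fin m) 𝕜} (hW : W ∈ Matrix.unitaryGroup (Fin m) 𝕜)
    (i : Fin m) : ∑ j, ‖W i j‖ ^ 2 = 1 := by
  have h := sum_norm_sq_col (Q := Wᴴ)
    (by rw [Matrix.conjTranspose_conjTranspose]; exact Matrix.mem_unitaryGroup_iff.1 hW) i
  simpa using h

theorem norm_conjTranspose_mul_apply_le_one {X : Matrix (Fin l) (Fin m) 𝕜}
    {Y : Matrix (Fin l) (Fin n) 𝕜} (hX : Xᴴ * X = 1) (hY : Yᴴ * Y = 1) (i : Fin m) (j : Fin n) :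
    ‖(Xᴴ * Y) i j‖ ≤ 1 := by
  have h1 : ‖WithLp.toLp 2 (Xᵀ i)‖ = 1 := by
    rw [EuclideanSpace.norm_eq, Real.sqrt_eq_one]
    exact sum_norm_sq_col hX i
  have h2 : ‖WithLp.toLp 2 (Yᵀ j)‖ = 1 := by
    rw [EuclideanSpace.norm_eq, Real.sqrt_eq_one]
    exact sum_norm_sq_col hY j
  have h := norm_inner_le_norm (𝕜 := 𝕜) (WithLp.toLp 2 (Xᵀ i)) (WithLp.toLp 2 (Yᵀ j))
  rw [h1, h2, one_mul] at h
  convert h using 2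
  simp [Matrix.mul_apply, PiLp.inner_apply, mul_comm]

end Frobenius

/-! ### Eigenvalues and invariant subspaces of Hermitian matrices under perturbation -/

section Perturbation

variable {𝕜 : Type*} [RCLike 𝕜] {m : ℕ}

theorem norm_sq_diagonal_mul_sub_mul_diagonal (a b : Fin m → ℝ) (W : Matrix (Fin m) (Fin m) 𝕜) :
    ‖Matrix.diagonal (fun i => (a i : 𝕜)) * W - W * Matrix.diagonal (fun i => (b i : 𝕜))‖ ^ 2 =
      ∑ i, ∑ j, (a i - b j) ^ 2 * ‖W i j‖ ^ 2 := by
  rw [frobenius_norm_sq]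
  refine Finset.sum_congr rfl fun i _ => Finset.sum_congr rfl fun j _ => ?_
  rw [Matrix.sub_apply, Matrix.diagonal_mul, Matrix.mul_diagonal, mul_comm (W i j), ← sub_mul,
    norm_mul, mul_pow, ← RCLike.ofReal_sub, RCLike.norm_ofReal, sq_abs]

/-- One half of Weyl's inequality in the Frobenius norm. The squared moduli of the entries of the
unitary `W` form a doubly stochastic matrix, so the entries in its first `k + 1` rows that lie
outside the first `k` columns have total mass at least `1`; on all of these `a i - b j` is at least
`a k - b k`. -/
theorem sub_le_norm_diagonal_mul_sub {a b : Fin m → ℝ} (ha : Antitone a) (hb : Antitone b)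
    {W : Matrix (Fin m) (Fin m) 𝕜} (hW : W ∈ Matrix.unitaryGroup (Fin m) 𝕜) (k : Fin m) :
    a k - b k ≤ ‖Matrix.diagonal (fun i => (a i : 𝕜)) * W -
      W * Matrix.diagonal (fun i => (b i : 𝕜))‖ := by
  rcases le_or_gt (a k - b k) 0 with h | h
  · exact h.trans (norm_nonneg _)
  refine le_of_sq_le_sq ?_ (norm_nonneg _)
  rw [norm_sq_diagonal_mul_sub_mul_diagonal]
  have hrow : ∑ i ∈ Finset.Iic k, ∑ j, ‖W i j‖ ^ 2 = (k : ℝ) + 1 := by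
    rw [Finset.sum_congr rfl fun i _ => sum_norm_sq_row hW i]
    simp
  have hcol : ∑ i ∈ Finset.Iic k, ∑ j ∈ Finset.Iio k, ‖W i j‖ ^ 2 ≤ k := by
    rw [Finset.sum_comm]
    calc _ ≤ ∑ j ∈ Finset.Iio k, ∑ i, ‖W i j‖ ^ 2 :=
          Finset.sum_le_sum fun j _ => Finset.sum_le_univ_sum_of_nonneg fun i => by positivity
      _ = k := by
          rw [Finset.sum_congr rfl fun j _ =>
            sum_norm_sq_col (Matrix.mem_unitaryGroup_iff'.1 hW) j]
          simp
  have hmass : 1 ≤ ∑ i ∈ Finset.Iic k, ∑ j ∈ (Finset.Iio k)ᶜ, ‖W i j‖ ^ 2 := by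
    have : ∑ i ∈ Finset.Iic k, ∑ j ∈ Finset.Iio k, ‖W i j‖ ^ 2 +
        ∑ i ∈ Finset.Iic k, ∑ j ∈ (Finset.Iio k)ᶜ, ‖W i j‖ ^ 2 = (k : ℝ) + 1 := by
      rw [← hrow, ← Finset.sum_add_distrib]
      exact Finset.sum_congr rfl fun i _ => Finset.sum_add_sum_compl _ _
    linarith
  calc (a k - b k) ^ 2
      ≤ (a k - b k) ^ 2 * ∑ i ∈ Finset.Iic k, ∑ j ∈ (Finset.Iio k)ᶜ, ‖W i j‖ ^ 2 :=
        le_mul_of_one_le_right (sq_nonneg _) hmass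
    _ = ∑ i ∈ Finset.Iic k, ∑ j ∈ (Finset.Iio k)ᶜ, (a k - b k) ^ 2 * ‖W i j‖ ^ 2 := by
        simp_rw [Finset.mul_sum]
    _ ≤ ∑ i ∈ Finset.Iic k, ∑ j ∈ (Finset.Iio k)ᶜ, (a i - b j) ^ 2 * ‖W i j‖ ^ 2 := by
        refine Finset.sum_le_sum fun i hi => Finset.sum_le_sum fun j hj => ?_
        have h1 := ha (Finset.mem_Iic.1 hi)
        have h2 : b j ≤ b k := hb (by simpa using hj)
        gcongr
    _ ≤ ∑ i ∈ Finset.Iic k, ∑ j, (a i - b j) ^ 2 * ‖W i j‖ ^ 2 :=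
        Finset.sum_le_sum fun i _ => Finset.sum_le_univ_sum_of_nonneg fun j => by positivity
    _ ≤ _ := Finset.sum_le_univ_sum_of_nonneg fun i => Finset.sum_nonneg fun j _ => by positivity

theorem abs_sub_le_norm_diagonal_mul_sub {a b : Fin m → ℝ} (ha : Antitone a) (hb : Antitone b)
    {W : Matrix (Fin m) (Fin m) 𝕜} (hW : W ∈ Matrix.unitaryGroup (Fin m) 𝕜) (k : Fin m) :
    |a k - b k| ≤ ‖Matrix.diagonal (fun i => (a i : 𝕜)) * W -
      W * Matrix.diagonal (fun i => (b i : 𝕜))‖ := by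
  refine abs_sub_le_iff.2 ⟨sub_le_norm_diagonal_mul_sub ha hb hW k, ?_⟩
  have h := sub_le_norm_diagonal_mul_sub hb ha (Unitary.star_mem hW) k
  rw [Matrix.star_eq_conjTranspose] at h
  refine h.trans_eq ?_
  rw [← norm_neg, ← Matrix.frobenius_norm_conjTranspose]
  congr 1
  simp [Matrix.diagonal_conjTranspose, Pi.star_def]

/-- A form of the `sin θ` theorem of Davis and Kahan: the part of `W` that couples two spectrally
separated index sets is controlled by the perturbation. -/
theorem gap_sq_mul_sum_norm_sq_le {a b : Fin m → ℝ} (W : Matrix (Fin m) (Fin m) 𝕜)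
    {p : Finset (Fin m)} {g : ℝ} (hg : 0 ≤ g) (h : ∀ i ∉ p, ∀ j ∈ p, g ≤ |a i - b j|) :
    g ^ 2 * ∑ i ∈ pᶜ, ∑ j ∈ p, ‖W i j‖ ^ 2 ≤ ‖Matrix.diagonal (fun i => (a i : 𝕜)) * W -
      W * Matrix.diagonal (fun i => (b i : 𝕜))‖ ^ 2 := by
  rw [norm_sq_diagonal_mul_sub_mul_diagonal]
  calc g ^ 2 * ∑ i ∈ pᶜ, ∑ j ∈ p, ‖W i j‖ ^ 2
      = ∑ i ∈ pᶜ, ∑ j ∈ p, g ^ 2 * ‖W i j‖ ^ 2 := by simp_rw [Finset.mul_sum]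
    _ ≤ ∑ i ∈ pᶜ, ∑ j ∈ p, (a i - b j) ^ 2 * ‖W i j‖ ^ 2 := by
        refine Finset.sum_le_sum fun i hi => Finset.sum_le_sum fun j hj => ?_
        have := h i (Finset.mem_compl.1 hi) j hj
        rw [← sq_abs (a i - b j)]
        gcongr
    _ ≤ ∑ i ∈ pᶜ, ∑ j, (a i - b j) ^ 2 * ‖W i j‖ ^ 2 :=
        Finset.sum_le_sum fun i _ => Finset.sum_le_univ_sum_of_nonneg fun j => by positivity
    _ ≤ _ := Finset.sum_le_univ_sum_of_nonneg fun i => Finset.sum_nonneg fun j _ => by positivity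

end Perturbation

/-! ### Singular value decompositions -/

section SVD

variable {𝕜 : Type*} [RCLike 𝕜] {m n : ℕ}

theorem sv_nonneg (A : Matrix (Fin m) (Fin n) 𝕜) (i : ℕ) : 0 ≤ sv A i :=
  LinearMap.singularValues_nonneg _ i

theorem sv_antitone (A : Matrix (Fin m) (Fin n) 𝕜) : Antitone (sv A) :=
  LinearMap.singularValues_antitone _

theorem sv_eq_zero_of_le (A : Matrix (Fin m) (Fin n) 𝕜) {i : ℕ} (hi : m ≤ i) : sv A i = 0 := by
  refine (LinearMap.singularValues_eq_zero_iff_le_finrank_range _).2 (le_trans ?_ hi)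
  simpa using Submodule.finrank_le (LinearMap.range (Matrix.toEuclideanLin A))

/-- The matrix whose columns are the vectors of an orthonormal basis. -/
noncomputable def basisMatrix (b : OrthonormalBasis (Fin m) 𝕜 (EuclideanSpace 𝕜 (Fin m))) :
    Matrix (Fin m) (Fin m) 𝕜 :=
  Matrix.of fun k i => b i k

theorem basisMatrix_mem_unitaryGroup
    (b : OrthonormalBasis (Fin m) 𝕜 (EuclideanSpace 𝕜 (Fin m))) :
    basisMatrix b ∈ Matrix.unitaryGroup (Fin m) 𝕜 := by
  rw [Matrix.mem_unitaryGroup_iff']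
  ext i j
  have h := orthonormal_iff_ite.1 b.orthonormal i j
  rw [Matrix.one_apply, ← h]
  simp [basisMatrix, Matrix.mul_apply, Matrix.star_eq_conjTranspose, PiLp.inner_apply, mul_comm]

/-- Every matrix has a full singular value decomposition. The columns of `V` are eigenvectors `v j`
of `Aᴴ * A`, and the columns of `U` extend the orthonormal family of the `(sv A j)⁻¹ • A v j`. -/
theorem exists_isFullSVD (A : Matrix (Fin m) (Fin n) 𝕜) : ∃ U V, IsFullSVD A U V := by
  have hn : Module.finrank 𝕜 (EuclideanSpace 𝕜 (Fin n)) = n := by simp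
  set T := Matrix.toEuclideanLin A with hT
  set v := T.isSymmetric_adjoint_comp_self.eigenvectorBasis hn with hv
  have hinner : ∀ i j : Fin n, inner 𝕜 (T (v i)) (T (v j)) =
      if i = j then ((sv A j ^ 2 : ℝ) : 𝕜) else 0 := by
    intro i j
    have h1 := T.isSymmetric_adjoint_comp_self.apply_eigenvectorBasis hn j
    rw [LinearMap.comp_apply, ← T.sq_singularValues_fin hn j] at h1
    rw [← LinearMap.adjoint_inner_right, h1, inner_smul_right,
      orthonormal_iff_ite.1 v.orthonormal i j]
    simp [sv, hT]
  have hzero : ∀ j : Fin n, sv A j = 0 → T (v j) = 0 := by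
    intro j hj
    have := hinner j j
    rw [hj] at this
    simpa using this
  let w : Fin m → EuclideanSpace 𝕜 (Fin m) := fun i =>
    if h : (i : ℕ) < n then ((sv A i : ℝ) : 𝕜)⁻¹ • T (v ⟨i, h⟩) else 0
  have hlt : ∀ i : Fin m, sv A i ≠ 0 → (i : ℕ) < n := by
    intro i hi
    by_contra h
    exact hi (LinearMap.singularValues_of_finrank_le _ (by simpa using h))
  have hw : Orthonormal 𝕜 ({i : Fin m | sv A i ≠ 0}.domRestrict w) := by
    rw [orthonormal_iff_ite]
    rintro ⟨i, hi⟩ ⟨j, hj⟩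
    have hi' : ((sv A i : ℝ) : 𝕜) ≠ 0 := by exact_mod_cast hi
    simp only [Set.domRestrict_apply, w, hlt i hi, hlt j hj, dif_pos, inner_smul_left,
      inner_smul_right, hinner, Subtype.mk.injEq, Fin.mk.injEq, Fin.val_inj]
    split_ifs with hij
    · subst hij
      simp
      field_simp
    · simp
  obtain ⟨b, hb⟩ := hw.exists_orthonormalBasis_extension_of_card_eq (by simp)
  refine ⟨basisMatrix b, basisMatrix v, basisMatrix_mem_unitaryGroup b,
    basisMatrix_mem_unitaryGroup v, ?_⟩
  have hV := Matrix.mem_unitaryGroup_iff.1 (basisMatrix_mem_unitaryGroup v)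
  rw [Matrix.star_eq_conjTranspose] at hV
  suffices h : A * basisMatrix v = basisMatrix b * sigmaMatrix A by
    rw [← h, Matrix.mul_assoc, hV, Matrix.mul_one]
  ext k j
  have hl : (A * basisMatrix v) k j = T (v j) k := by
    simp [hT, Matrix.mul_apply, basisMatrix, Matrix.toLpLin_apply, Matrix.mulVec, dotProduct]
  rw [hl, Matrix.mul_apply]
  by_cases hj : sv A j = 0
  · rw [hzero j hj, Finset.sum_eq_zero]
    · rfl
    · intro i _
      by_cases hij : (i : ℕ) = j <;> simp [sigmaMatrix, hij, hj]
  · have hjm : (j : ℕ) < m := by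
      by_contra h
      exact hj (sv_eq_zero_of_le A (not_lt.1 h))
    have hj' : ((sv A j : ℝ) : 𝕜) ≠ 0 := by exact_mod_cast hj
    rw [Finset.sum_eq_single (⟨j, hjm⟩ : Fin m)]
    · have := hb ⟨j, hjm⟩ hj
      simp only [w, j.2, dif_pos] at this
      simp [sigmaMatrix, basisMatrix, this]
      field_simp
    · intro i _ hi
      have : (i : ℕ) ≠ j := fun h => hi (Fin.ext h)
      simp [sigmaMatrix, this]
    · simp

theorem sum_sv_sq (M : Matrix (Fin n) (Fin n) 𝕜) : ∑ i : Fin n, sv M i ^ 2 = ‖M‖ ^ 2 := by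
  obtain ⟨U, V, hU, hV, hM⟩ := exists_isFullSVD M
  conv_rhs => rw [hM]
  have hV' : Vᴴ ∈ Matrix.unitaryGroup (Fin n) 𝕜 := Unitary.star_mem hV
  rw [frobenius_norm_mul_unitary hV',
    frobenius_norm_isometry_mul (Matrix.mem_unitaryGroup_iff'.1 hU), frobenius_norm_sq]
  refine Finset.sum_congr rfl fun i _ => ?_
  rw [Finset.sum_eq_single i]
  · simp [sigmaMatrix]
  · intro j _ hj
    have : (i : ℕ) ≠ j := fun h => hj (Fin.ext h).symm
    simp [sigmaMatrix, this]
  · simp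

theorem sv_conjTranspose_mul_le_one {d : ℕ} {Q Q' : Matrix (Fin m) (Fin d) 𝕜} (hQ : Qᴴ * Q = 1)
    (hQ' : Q'ᴴ * Q' = 1) (i : Fin d) : sv (Qᴴ * Q') i ≤ 1 := by
  obtain ⟨U, V, hU, hV, hM⟩ := exists_isFullSVD (Qᴴ * Q')
  have hU' : Uᴴ * U = 1 := Matrix.mem_unitaryGroup_iff'.1 hU
  have hV' : Vᴴ * V = 1 := Matrix.mem_unitaryGroup_iff'.1 hV
  have h1 : (Q * U)ᴴ * (Q * U) = 1 := by
    rw [Matrix.conjTranspose_mul, Matrix.mul_assoc, ← Matrix.mul_assoc Qᴴ, hQ, Matrix.one_mul, hU']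
  have h2 : (Q' * V)ᴴ * (Q' * V) = 1 := by
    rw [Matrix.conjTranspose_mul, Matrix.mul_assoc, ← Matrix.mul_assoc Q'ᴴ, hQ', Matrix.one_mul,
      hV']
  have h3 : (Q * U)ᴴ * (Q' * V) = sigmaMatrix (Qᴴ * Q') := by
    calc (Q * U)ᴴ * (Q' * V) = Uᴴ * (Qᴴ * Q') * V := by
          simp [Matrix.conjTranspose_mul, Matrix.mul_assoc]
      _ = (Uᴴ * U) * sigmaMatrix (Qᴴ * Q') * (Vᴴ * V) := by
          conv_lhs => rw [hM]
          simp [Matrix.mul_assoc]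
      _ = _ := by rw [hU', hV', Matrix.one_mul, Matrix.mul_one]
  have h := norm_conjTranspose_mul_apply_le_one h1 h2 i i
  rw [h3] at h
  simpa [sigmaMatrix, abs_of_nonneg (sv_nonneg _ _)] using h

end SVD

/-! ### Comparison of the three distances -/

section Distances

variable {𝕜 : Type*} [RCLike 𝕜] {d m : ℕ}

theorem principalAngle_nonneg (P P' : Gr 𝕜 d m) (i : Fin d) : 0 ≤ principalAngle P P' i :=
  Real.arccos_nonneg _

theorem principalAngle_le_pi_div_two (P P' : Gr 𝕜 d m) (i : Fin d) :
    principalAngle P P' i ≤ Real.pi / 2 :=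
  Real.arccos_le_pi_div_two.2 (sv_nonneg _ _)

theorem grDist_nonneg (t : GrDist) (P P' : Gr 𝕜 d m) : 0 ≤ grDist t P P' := by
  cases t <;> exact Real.sqrt_nonneg _

theorem grDist_chordal_le (t : GrDist) (P P' : Gr 𝕜 d m) :
    grDist .chordal P P' ≤ grDist t P P' := by
  have h0 := principalAngle_nonneg P P'
  have h1 := principalAngle_le_pi_div_two P P'
  have hs : ∀ i, 0 ≤ Real.sin (principalAngle P P' i) := fun i =>
    Real.sin_nonneg_of_nonneg_of_le_pi (h0 i) (by linarith [h1 i, Real.pi_pos])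
  cases t
  · exact le_rfl
  · exact Real.sqrt_le_sqrt <| Finset.sum_le_sum fun i _ =>
      pow_le_pow_left₀ (hs i) (Real.sin_le (h0 i)) 2
  · refine Real.sqrt_le_sqrt <| Finset.sum_le_sum fun i _ => pow_le_pow_left₀ (hs i) ?_ 2
    have h2 : 0 ≤ Real.sin (principalAngle P P' i / 2) :=
      Real.sin_nonneg_of_nonneg_of_le_pi (by linarith [h0 i]) (by linarith [h1 i, Real.pi_pos])
    have h3 := Real.cos_le_one (principalAngle P P' i / 2)
    have h4 := Real.sin_two_mul (principalAngle P P' i / 2)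
    rw [mul_div_cancel₀ _ (two_ne_zero' ℝ)] at h4
    rw [h4]
    exact mul_le_of_le_one_right (by positivity) h3

theorem grDist_le_grassmann (t : GrDist) (P P' : Gr 𝕜 d m) :
    grDist t P P' ≤ grDist .grassmann P P' := by
  have h0 := principalAngle_nonneg P P'
  have h1 := principalAngle_le_pi_div_two P P'
  cases t
  · exact grDist_chordal_le _ _ _
  · exact le_rfl
  · refine Real.sqrt_le_sqrt <| Finset.sum_le_sum fun i _ => pow_le_pow_left₀ ?_ ?_ 2
    · exact mul_nonneg zero_le_two <|
        Real.sin_nonneg_of_nonneg_of_le_pi (by linarith [h0 i]) (by linarith [h1 i, Real.pi_pos])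
    · linarith [Real.sin_le (x := principalAngle P P' i / 2) (by linarith [h0 i])]

/-- Since `θ cos θ ≤ sin θ` and `cos θ ≥ 1 - sin θ ^ 2`, the Grassmann distance is, to first order,
at most the chordal distance. -/
theorem grassmann_mul_le_chordal (P P' : Gr 𝕜 d m) :
    (1 - grDist .chordal P P' ^ 2) * grDist .grassmann P P' ≤ grDist .chordal P P' := by
  rcases le_or_gt (1 - grDist .chordal P P' ^ 2) 0 with h | h
  · exact (mul_nonpos_of_nonpos_of_nonneg h (grDist_nonneg _ _ _)).trans (grDist_nonneg _ _ _)
  refine le_of_sq_le_sq ?_ (grDist_nonneg _ _ _)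
  have hc : grDist .chordal P P' ^ 2 = ∑ i, Real.sin (principalAngle P P' i) ^ 2 :=
    Real.sq_sqrt (Finset.sum_nonneg fun i _ => sq_nonneg _)
  have hG : grDist .grassmann P P' ^ 2 = ∑ i, principalAngle P P' i ^ 2 :=
    Real.sq_sqrt (Finset.sum_nonneg fun i _ => sq_nonneg _)
  rw [mul_pow, hG, Finset.mul_sum]
  conv_rhs => rw [hc]
  refine Finset.sum_le_sum fun i _ => ?_
  rw [← mul_pow]
  have h0 := principalAngle_nonneg P P' i
  have h1 := principalAngle_le_pi_div_two P P' i
  refine pow_le_pow_left₀ (mul_nonneg h.le h0) ?_ 2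
  have hsin : Real.sin (principalAngle P P' i) ^ 2 ≤ grDist .chordal P P' ^ 2 := by
    rw [hc]
    exact Finset.single_le_sum (f := fun i => Real.sin (principalAngle P P' i) ^ 2)
      (fun i _ => sq_nonneg _) (Finset.mem_univ i)
  set θ := principalAngle P P' i
  have hcos0 : 0 ≤ Real.cos θ := Real.cos_nonneg_of_neg_pi_div_two_le_of_le (by linarith) h1
  have hcos : 1 - grDist .chordal P P' ^ 2 ≤ Real.cos θ := by
    nlinarith [Real.sin_sq_add_cos_sq θ, Real.cos_le_one θ]
  have hmul : θ * Real.cos θ ≤ Real.sin θ := by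
    rcases h1.eq_or_lt with e | hlt
    · rw [e]
      simp
    · have h2 := Real.le_tan h0 hlt
      have h3 : 0 < Real.cos θ := Real.cos_pos_of_mem_Ioo ⟨by linarith, hlt⟩
      rwa [Real.tan_eq_sin_div_cos, le_div_iff₀ h3] at h2
  nlinarith

theorem grDist_eq_zero_of_chordal_eq_zero {P P' : Gr 𝕜 d m} (h : grDist .chordal P P' = 0)
    (t : GrDist) : grDist t P P' = 0 := by
  have h1 := grassmann_mul_le_chordal P P'
  rw [h] at h1
  linarith [grDist_le_grassmann t P P', grDist_nonneg t P P']

/-- In terms of singular value decompositions with left factors `U` and `U'`, the chordal distance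
is the Frobenius norm of the block of `Uᴴ * U'` that couples `p` to its complement. -/
theorem chordal_leftMap_sq {n : ℕ} {p : Finset (Fin m)} (A A' : leftDomain 𝕜 m n p)
    {U U' : Matrix (Fin m) (Fin m) 𝕜} {V V' : Matrix (Fin n) (Fin n) 𝕜}
    (h : IsFullSVD A.1 U V) (h' : IsFullSVD A'.1 U' V') :
    grDist .chordal (leftMap A) (leftMap A') ^ 2 = ∑ i ∈ pᶜ, ∑ j ∈ p, ‖(Uᴴ * U') i j‖ ^ 2 := by
  have hQ := cols_conjTranspose_mul h.1 p
  have hQ' := cols_conjTranspose_mul h'.1 p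
  have hW : Uᴴ * U' ∈ Matrix.unitaryGroup (Fin m) 𝕜 := mul_mem (Unitary.star_mem h.1) h'.1
  have hM : (cols U p)ᴴ * cols U' p =
      (Uᴴ * U').submatrix (p.orderEmbOfFin rfl) (p.orderEmbOfFin rfl) := by
    ext i j
    simp [cols, Matrix.mul_apply]
  have hreindex : ∀ f : Fin m → ℝ, ∑ i, f (p.orderEmbOfFin rfl i) = ∑ i ∈ p, f i := by
    intro f
    have := Finset.sum_map Finset.univ (p.orderEmbOfFin rfl).toEmbedding f
    rw [Finset.map_orderEmbOfFin_univ] at this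
    exact this.symm
  have hnorm : ‖(cols U p)ᴴ * cols U' p‖ ^ 2 = ∑ i ∈ p, ∑ j ∈ p, ‖(Uᴴ * U') i j‖ ^ 2 := by
    rw [frobenius_norm_sq, hM, ← hreindex]
    refine Finset.sum_congr rfl fun i _ => ?_
    rw [← hreindex]
    rfl
  have hsum : ∑ i ∈ p, ∑ j ∈ p, ‖(Uᴴ * U') i j‖ ^ 2 + ∑ i ∈ pᶜ, ∑ j ∈ p, ‖(Uᴴ * U') i j‖ ^ 2 =
      p.card := by
    rw [Finset.sum_add_sum_compl, Finset.sum_comm, Finset.sum_congr rfl fun j _ =>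
      sum_norm_sq_col (Matrix.mem_unitaryGroup_iff'.1 hW) j]
    simp
  have hc : grDist .chordal (leftMap A) (leftMap A') ^ 2 =
      ∑ i, Real.sin (principalAngle (leftMap A) (leftMap A') i) ^ 2 :=
    Real.sq_sqrt (Finset.sum_nonneg fun i _ => sq_nonneg _)
  have hsin : ∀ i, Real.sin (principalAngle (leftMap A) (leftMap A') i) ^ 2 =
      1 - sv ((cols U p)ᴴ * cols U' p) i ^ 2 := by
    intro i
    rw [principalAngle_eq _ _ hQ (leftMap_eq A h) hQ' (leftMap_eq A' h'), Real.sin_arccos,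
      Real.sq_sqrt]
    have h1 := sv_conjTranspose_mul_le_one hQ hQ' i
    have h2 := sv_nonneg ((cols U p)ᴴ * cols U' p) i
    nlinarith
  rw [hc, Finset.sum_congr rfl fun i _ => hsin i, Finset.sum_sub_distrib, sum_sv_sq, hnorm]
  simp only [Finset.sum_const, Finset.card_univ, Fintype.card_fin, nsmul_eq_mul, mul_one]
  linarith

end Distances

/-! ### The condition number is finite and independent of the distance -/

section Condition

variable {𝕜 : Type*} [RCLike 𝕜] {m n : ℕ} {p : Finset (Fin m)}

theorem norm_mul_conjTranspose_sub_le (A A' : Matrix (Fin m) (Fin n) 𝕜) :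
    ‖A * Aᴴ - A' * A'ᴴ‖ ≤ (‖A‖ + ‖A'‖) * ‖A - A'‖ := by
  have h : A * Aᴴ - A' * A'ᴴ = (A - A') * Aᴴ + A' * (A - A')ᴴ := by
    rw [Matrix.conjTranspose_sub, Matrix.sub_mul, Matrix.mul_sub]
    abel
  rw [h]
  refine (norm_add_le _ _).trans ?_
  have h1 := Matrix.frobenius_norm_mul (A - A') Aᴴ
  have h2 := Matrix.frobenius_norm_mul A' (A - A')ᴴ
  rw [Matrix.frobenius_norm_conjTranspose] at h1 h2
  linarith

theorem IsFullSVD.norm_diagonal_mul_sub {A A' : Matrix (Fin m) (Fin n) 𝕜}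
    {U U' : Matrix (Fin m) (Fin m) 𝕜} {V V' : Matrix (Fin n) (Fin n) 𝕜}
    (h : IsFullSVD A U V) (h' : IsFullSVD A' U' V') :
    ‖Matrix.diagonal (fun i : Fin m => ((sv A i ^ 2 : ℝ) : 𝕜)) * (Uᴴ * U') -
      (Uᴴ * U') * Matrix.diagonal (fun i : Fin m => ((sv A' i ^ 2 : ℝ) : 𝕜))‖ =
      ‖A * Aᴴ - A' * A'ᴴ‖ := by
  have hU : Uᴴ * U = 1 := Matrix.mem_unitaryGroup_iff'.1 h.1
  have hU' : U'ᴴ * U' = 1 := Matrix.mem_unitaryGroup_iff'.1 h'.1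
  have hUH : Uᴴᴴ * Uᴴ = 1 := by
    rw [Matrix.conjTranspose_conjTranspose]
    exact Matrix.mem_unitaryGroup_iff.1 h.1
  rw [← frobenius_norm_mul_unitary h'.1 (A * Aᴴ - A' * A'ᴴ),
    ← frobenius_norm_isometry_mul hUH ((A * Aᴴ - A' * A'ᴴ) * U'), h.mul_conjTranspose, h'.mul_conjTranspose, Matrix.sub_mul, Matrix.mul_sub]
  congr 2
  · calc _ = (Uᴴ * U) * Matrix.diagonal (fun i : Fin m => ((sv A i ^ 2 : ℝ) : 𝕜)) * (Uᴴ * U') := by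
          rw [hU, Matrix.one_mul]
      _ = _ := by simp [Matrix.mul_assoc]
  · calc _ = (Uᴴ * U') * Matrix.diagonal (fun i : Fin m => ((sv A' i ^ 2 : ℝ) : 𝕜)) *
          (U'ᴴ * U') := by rw [hU', Matrix.mul_one]
      _ = _ := by simp [Matrix.mul_assoc]

theorem exists_pos_gap (A : leftDomain 𝕜 m n p) :
    ∃ g : ℝ, 0 < g ∧ ∀ i ∉ p, ∀ j ∈ p, g ≤ |sv A.1 i ^ 2 - sv A.1 j ^ 2| := by
  obtain ⟨U, V, h, hs⟩ := A.2
  have hev : ∀ᶠ g : ℝ in 𝓝[>] 0, ∀ i j : Fin m, i ∉ p → j ∈ p →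
      g ≤ |sv A.1 i ^ 2 - sv A.1 j ^ 2| := by
    refine eventually_all.2 fun i => eventually_all.2 fun j => ?_
    by_cases hij : i ∉ p ∧ j ∈ p
    · have hpos : 0 < |sv A.1 i ^ 2 - sv A.1 j ^ 2| := by
        rw [abs_pos, sub_ne_zero, Ne, sq_eq_sq₀ (sv_nonneg _ _) (sv_nonneg _ _)]
        exact (separated h hs hij.2 hij.1).symm
      filter_upwards [nhdsWithin_le_nhds (Iio_mem_nhds hpos)] with g hg _ _
      exact hg.le
    · exact Eventually.of_forall fun g h1 h2 => absurd ⟨h1, h2⟩ hij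
  obtain ⟨g, hg, hg0⟩ := (hev.and self_mem_nhdsWithin).exists
  exact ⟨g, hg0, fun i hi j hj => hg i j hi hj⟩

/-- The condition number is finite: by Weyl's inequality the squared singular values of `A'` stay
separated from those of `A`, so the `sin θ` theorem gives a local Lipschitz bound. -/
theorem condLeft_chordal_ne_top (A : leftDomain 𝕜 m n p) : condLeft .chordal A ≠ ⊤ := by
  obtain ⟨g, hg, hgap⟩ := exists_pos_gap A
  -- `M` is a Lipschitz constant at `A` of `A' ↦ A' * A'ᴴ` on the ball of radius `1`; within distance
  -- `g / (2 * M)` the squared singular values move by at most half the gap `g`.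
  set M := 2 * ‖A.1‖ + 1 with hM
  have hM0 : 0 < M := by positivity
  refine ne_top_of_le_ne_top (ENNReal.ofReal_ne_top (r := 2 * M / g))
    (riceCond_le_ofReal (ε := min 1 (g / (2 * M))) (by positivity) fun A' _ hA' => ?_)
  have hA1 := hA'.trans (min_le_left _ _)
  have hA2 := hA'.trans (min_le_right _ _)
  obtain ⟨U, V, h⟩ := exists_isFullSVD A.1
  obtain ⟨U', V', h'⟩ := exists_isFullSVD A'.1
  have hW : Uᴴ * U' ∈ Matrix.unitaryGroup (Fin m) 𝕜 := mul_mem (Unitary.star_mem h.1) h'.1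
  have hΔ := norm_mul_conjTranspose_sub_le A.1 A'.1
  rw [← h.norm_diagonal_mul_sub h'] at hΔ
  have hA'n : ‖A'.1‖ ≤ ‖A.1‖ + 1 := by
    have := norm_sub_norm_le A'.1 A.1
    rw [norm_sub_rev] at this
    linarith
  replace hΔ := hΔ.trans (mul_le_mul_of_nonneg_right
    (by rw [hM]; linarith : ‖A.1‖ + ‖A'.1‖ ≤ M) (norm_nonneg _))
  have hanti : ∀ B : Matrix (Fin m) (Fin n) 𝕜, Antitone fun i : Fin m => sv B i ^ 2 :=
    fun B i j hij => pow_le_pow_left₀ (sv_nonneg _ _) (sv_antitone B hij) 2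
  have hweyl := abs_sub_le_norm_diagonal_mul_sub (hanti A.1) (hanti A'.1) hW
  have hsmall : M * ‖A.1 - A'.1‖ ≤ g / 2 := by
    calc M * ‖A.1 - A'.1‖ ≤ M * (g / (2 * M)) := mul_le_mul_of_nonneg_left hA2 hM0.le
      _ = g / 2 := by field_simp
  have hgap' : ∀ i ∉ p, ∀ j ∈ p, g / 2 ≤ |sv A.1 i ^ 2 - sv A'.1 j ^ 2| := by
    intro i hi j hj
    have h1 := hgap i hi j hj
    have h2 := (hweyl j).trans (hΔ.trans hsmall)
    have h3 := abs_sub_le (sv A.1 i ^ 2) (sv A'.1 j ^ 2) (sv A.1 j ^ 2)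
    rw [abs_sub_comm (sv A'.1 j ^ 2)] at h3
    linarith
  have hsin := gap_sq_mul_sum_norm_sq_le (Uᴴ * U') (by positivity) hgap'
  rw [← chordal_leftMap_sq A A' h h', ← mul_pow] at hsin
  have hfin := (le_of_sq_le_sq hsin (norm_nonneg _)).trans hΔ
  rw [div_mul_eq_mul_div, le_div_iff₀ hg]
  linarith

theorem condLeft_mono {t t' : GrDist} (A : leftDomain 𝕜 m n p)
    (h : ∀ P P' : Gr 𝕜 p.card m, grDist t P P' ≤ grDist t' P P') :
    condLeft t A ≤ condLeft t' A :=
  iInf_mono fun _ => iSup_mono fun x' => ENNReal.ofReal_le_ofReal <|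
    div_le_div_of_nonneg_right (h _ _) x'.2.1.le

theorem condLeft_grassmann_le_chordal (A : leftDomain 𝕜 m n p) :
    condLeft .grassmann A ≤ condLeft .chordal A := by
  refine ENNReal.le_of_forall_pos_le_add fun e he _ => ?_
  have htop := condLeft_chordal_ne_top A
  set κ := (condLeft .chordal A).toReal with hκ
  have hκ0 : 0 ≤ κ := ENNReal.toReal_nonneg
  have he' : (0 : ℝ) < e := he
  set c := κ + e / 2 with hc
  have hc0 : 0 < c := by positivity
  -- `η` is chosen so that `(1 - η) * (κ + e) = κ + e / 2`: once the squared chordal distance is at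
  -- most `η`, the chordal bound with constant `κ + e / 2` gives the Grassmann bound with `κ + e`.
  set η := (e / 2 : ℝ) / (κ + e) with hη
  have hη0 : 0 < η := by positivity
  have hηc : (1 - η) * (κ + e) = c := by
    rw [hη, hc]
    field_simp
    ring
  have hη1 : 0 < 1 - η := by
    by_contra hcon
    nlinarith
  have hlt : condLeft .chordal A < ENNReal.ofReal c := by
    rw [← ENNReal.ofReal_toReal htop, ENNReal.ofReal_lt_ofReal_iff hc0, ← hκ, hc]
    linarith
  obtain ⟨ε, hε, hb⟩ := exists_le_mul_of_riceCond_lt hc0.le hlt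
  have hgoal : condLeft .grassmann A ≤ ENNReal.ofReal (κ + e) := by
    refine riceCond_le_ofReal (ε := min ε (√η / c)) (by positivity) fun A' h0 h1 => ?_
    have h2 := hb A' h0 (h1.trans (min_le_left _ _))
    have h3 : c * ‖A.1 - A'.1‖ ≤ √η := by
      rw [← le_div_iff₀' hc0]
      exact h1.trans (min_le_right _ _)
    have hd := grDist_nonneg .chordal (leftMap A) (leftMap A')
    have h4 : grDist .chordal (leftMap A) (leftMap A') ^ 2 ≤ η :=
      (pow_le_pow_left₀ hd (h2.trans h3) 2).trans_eq (Real.sq_sqrt hη0.le)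
    have h5 := grassmann_mul_le_chordal (leftMap A) (leftMap A')
    have hG := grDist_nonneg .grassmann (leftMap A) (leftMap A')
    refine le_of_mul_le_mul_left ?_ hη1
    calc (1 - η) * grDist .grassmann (leftMap A) (leftMap A')
        ≤ (1 - grDist .chordal (leftMap A) (leftMap A') ^ 2) *
          grDist .grassmann (leftMap A) (leftMap A') :=
          mul_le_mul_of_nonneg_right (by linarith) hG
      _ ≤ c * ‖A.1 - A'.1‖ := h5.trans h2
      _ = (1 - η) * ((κ + e) * ‖A.1 - A'.1‖) := by rw [← mul_assoc, hηc]
  rwa [ENNReal.ofReal_add hκ0 he'.le, ENNReal.ofReal_toReal htop, ENNReal.ofReal_coe_nnreal]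
    at hgoal

theorem condLeft_eq_chordal (t : GrDist) (A : leftDomain 𝕜 m n p) :
    condLeft t A = condLeft .chordal A :=
  le_antisymm ((condLeft_mono A (grDist_le_grassmann t)).trans (condLeft_grassmann_le_chordal A))
    (condLeft_mono A (grDist_chordal_le t))

theorem grDist_leftMap_self (t : GrDist) (A : leftDomain 𝕜 m n p) :
    grDist t (leftMap A) (leftMap A) = 0 := by
  refine grDist_eq_zero_of_chordal_eq_zero (pow_eq_zero_iff two_ne_zero |>.1 ?_) t
  obtain ⟨U, V, h⟩ := exists_isFullSVD A.1
  have hU : Uᴴ * U = 1 := Matrix.mem_unitaryGroup_iff'.1 h.1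
  rw [chordal_leftMap_sq A A h h, hU]
  refine Finset.sum_eq_zero fun i hi => Finset.sum_eq_zero fun j hj => ?_
  have : i ≠ j := fun e => Finset.mem_compl.1 hi (e ▸ hj)
  simp [this]

end Condition

/-! ### Positivity of the condition number -/

section Positivity

variable {𝕜 : Type*} [RCLike 𝕜] {m n : ℕ} {p : Finset (Fin m)}

theorem sv_unitary_mul {X : Matrix (Fin m) (Fin m) 𝕜} (hX : X ∈ Matrix.unitaryGroup (Fin m) 𝕜)
    (A : Matrix (Fin m) (Fin n) 𝕜) : sv (X * A) = sv A := by
  have hX' : Xᴴ * X = 1 := Matrix.mem_unitaryGroup_iff'.1 hX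
  refine sv_eq_of_charpoly ?_
  rw [Matrix.conjTranspose_mul, Matrix.mul_assoc, ← Matrix.mul_assoc Xᴴ, hX', Matrix.one_mul]

theorem IsFullSVD.unitary_mul {A : Matrix (Fin m) (Fin n) 𝕜} {U : Matrix (Fin m) (Fin m) 𝕜}
    {V : Matrix (Fin n) (Fin n) 𝕜} (h : IsFullSVD A U V) {X : Matrix (Fin m) (Fin m) 𝕜}
    (hX : X ∈ Matrix.unitaryGroup (Fin m) 𝕜) : IsFullSVD (X * A) (X * U) V := by
  refine ⟨mul_mem hX h.1, h.2.1, ?_⟩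
  have hs : sigmaMatrix (X * A) = sigmaMatrix A := by
    simp only [sigmaMatrix, sv_unitary_mul hX]
  rw [hs]
  conv_lhs => rw [h.2.2]
  simp only [Matrix.mul_assoc]

theorem leftSingularSpace_unitary_mul {X : Matrix (Fin m) (Fin m) 𝕜}
    (hX : X ∈ Matrix.unitaryGroup (Fin m) 𝕜) (A : Matrix (Fin m) (Fin n) 𝕜) (s : ℝ) :
    leftSingularSpace (X * A) s = (leftSingularSpace A s).map (Matrix.toLin' X) := by
  have h1 : Xᴴ * X = 1 := Matrix.mem_unitaryGroup_iff'.1 hX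
  have h2 : X * Xᴴ = 1 := Matrix.mem_unitaryGroup_iff.1 hX
  ext v
  simp only [leftSingularSpace, Submodule.mem_map, Module.End.mem_eigenspace_iff,
    Matrix.toLin'_apply]
  constructor
  · intro hv
    refine ⟨Xᴴ *ᵥ v, ?_, by rw [Matrix.mulVec_mulVec, h2, Matrix.one_mulVec]⟩
    have := congrArg (Xᴴ *ᵥ ·) hv
    simp only [Matrix.mulVec_smul, Matrix.mulVec_mulVec] at this
    rw [← this, Matrix.mulVec_mulVec]
    congr 1
    calc A * Aᴴ * Xᴴ = (Xᴴ * X) * (A * Aᴴ * Xᴴ) := by rw [h1, Matrix.one_mul]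
      _ = _ := by simp [Matrix.conjTranspose_mul, Matrix.mul_assoc]
  · rintro ⟨w, hw, rfl⟩
    rw [← Matrix.mulVec_smul, ← hw]
    simp only [Matrix.mulVec_mulVec]
    congr 1
    calc X * A * (X * A)ᴴ * X = X * A * Aᴴ * (Xᴴ * X) := by
          simp [Matrix.conjTranspose_mul, Matrix.mul_assoc]
      _ = _ := by rw [h1, Matrix.mul_one, Matrix.mul_assoc]

theorem colSpan_mul (X U : Matrix (Fin m) (Fin m) 𝕜) :
    colSpan (X * U) p = (colSpan U p).map (Matrix.toLin' X) := by
  rw [colSpan, colSpan, Submodule.map_span, ← Set.image_comp]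
  congr 2

theorem unitary_mul_mem_leftDomain {X : Matrix (Fin m) (Fin m) 𝕜}
    (hX : X ∈ Matrix.unitaryGroup (Fin m) 𝕜) {A : Matrix (Fin m) (Fin n) 𝕜}
    (hA : A ∈ leftDomain 𝕜 m n p) : X * A ∈ leftDomain 𝕜 m n p := by
  obtain ⟨U, V, h, S, hS, hW⟩ := hA
  refine ⟨X * U, V, h.unitary_mul hX, S, by rwa [sv_unitary_mul hX], ?_⟩
  rw [colSpan_mul, hW]
  simp only [Submodule.map_iSup, leftSingularSpace_unitary_mul hX]

/-- Plane rotations: unitary matrices at distance `O(s)` from the identity with an off-diagonal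
entry equal to `s`. -/
theorem exists_unitary_near_one (𝕜 : Type*) [RCLike 𝕜] {i j : Fin m} (hij : i ≠ j) :
    ∃ C : ℝ, 0 ≤ C ∧ ∀ s : ℝ, 0 ≤ s → s ≤ 1 → ∃ R ∈ Matrix.unitaryGroup (Fin m) 𝕜,
      R j i = (s : 𝕜) ∧ ‖R - 1‖ ≤ C * s := by
  let E : Matrix (Fin m) (Fin m) 𝕜 := Matrix.single i i 1 + Matrix.single j j 1
  let K : Matrix (Fin m) (Fin m) 𝕜 := Matrix.single j i 1 - Matrix.single i j 1
  have hEE : E * E = E := by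
    simp [E, add_mul, mul_add, hij, hij.symm]
  have hEK : E * K = K := by
    simp [E, K, add_mul, mul_sub, hij, hij.symm]
  have hKE : K * E = K := by
    simp [E, K, sub_mul, mul_add, hij, hij.symm]
    abel
  have hKK : K * K = -E := by
    simp [E, K, sub_mul, mul_sub, hij, hij.symm]
    abel
  have hE : Eᴴ = E := by simp [E, Matrix.conjTranspose_add]
  have hK : Kᴴ = -K := by simp [K, Matrix.conjTranspose_sub]
  refine ⟨‖E‖ + ‖K‖, by positivity, fun s hs0 hs1 => ?_⟩
  set c := √(1 - s ^ 2) with hc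
  have hs2 : 0 ≤ 1 - s ^ 2 := by nlinarith
  have hc2 : c ^ 2 = 1 - s ^ 2 := Real.sq_sqrt hs2
  have hc0 : 0 ≤ c := Real.sqrt_nonneg _
  have hc1 : c ≤ 1 := Real.sqrt_le_one.2 (by nlinarith)
  refine ⟨1 + ((c - 1 : ℝ) : 𝕜) • E + (s : 𝕜) • K, ?_, ?_, ?_⟩
  · rw [Matrix.mem_unitaryGroup_iff']
    have hcs : ((c - 1 : ℝ) : 𝕜) + ((c - 1 : ℝ) : 𝕜) + ((c - 1 : ℝ) : 𝕜) * ((c - 1 : ℝ) : 𝕜) +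
        (s : 𝕜) * (s : 𝕜) = 0 := by
      have : (c - 1) + (c - 1) + (c - 1) * (c - 1) + s * s = 0 := by nlinarith
      exact_mod_cast this
    have hstar : star (1 + ((c - 1 : ℝ) : 𝕜) • E + (s : 𝕜) • K) =
        1 + ((c - 1 : ℝ) : 𝕜) • E - (s : 𝕜) • K := by
      simp only [Matrix.star_eq_conjTranspose, Matrix.conjTranspose_add,
        Matrix.conjTranspose_smul, hE, hK, Matrix.conjTranspose_one, RCLike.star_def,
        RCLike.conj_ofReal, smul_neg, sub_eq_add_neg]
    rw [hstar]
    generalize ((c - 1 : ℝ) : 𝕜) = x at hcs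
    generalize (s : 𝕜) = y at hcs
    have hexp : (1 + x • E - y • K) * (1 + x • E + y • K) =
        1 + (x + x + x * x + y * y) • E := by
      simp only [add_mul, sub_mul, mul_add, one_mul, mul_one, Matrix.smul_mul, Matrix.mul_smul,
        hEE, hEK, hKE, hKK, smul_smul, smul_neg]
      module
    rw [hexp, hcs, zero_smul, add_zero]
  · simp [E, K, hij, hij.symm, RCLike.real_smul_eq_coe_mul]
  · have h1 : 1 + ((c - 1 : ℝ) : 𝕜) • E + (s : 𝕜) • K - 1 =
        ((c - 1 : ℝ) : 𝕜) • E + (s : 𝕜) • K := by abel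
    rw [h1]
    refine (norm_add_le _ _).trans ?_
    rw [norm_smul, norm_smul, RCLike.norm_ofReal, RCLike.norm_ofReal, abs_of_nonneg hs0,
      abs_of_nonpos (by linarith)]
    have h2 : -(c - 1) ≤ s := by nlinarith
    have h3 := mul_le_mul_of_nonneg_right h2 (norm_nonneg E)
    linarith

/-- If `p` is neither empty nor everything, then rotating a left singular vector at a position in
`p` towards one at another position moves the left singular subspace at a positive rate. -/
theorem condLeft_chordal_ne_zero (A : leftDomain 𝕜 m n p) {i j : Fin m} (hi : i ∈ p)
    (hj : j ∉ p) : condLeft .chordal A ≠ 0 := by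
  obtain ⟨C, hC, hR⟩ := exists_unitary_near_one 𝕜 (fun e => hj (e ▸ hi) : i ≠ j)
  obtain ⟨U, V, h⟩ := exists_isFullSVD A.1
  have hU : Uᴴ * U = 1 := Matrix.mem_unitaryGroup_iff'.1 h.1
  have hU' : U * Uᴴ = 1 := Matrix.mem_unitaryGroup_iff.1 h.1
  set D := C * ‖A.1‖ + 1 with hD
  have hD0 : 0 < D := by positivity
  suffices hle : ENNReal.ofReal (1 / D) ≤ condLeft .chordal A from
    ((ENNReal.ofReal_pos.2 (by positivity)).trans_le hle).ne'
  refine ofReal_le_riceCond fun ε hε => ?_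
  have hs0 : 0 < min 1 (ε / D) := by positivity
  set s := min 1 (ε / D) with hs
  obtain ⟨R, hRu, hRs, hR1⟩ := hR s hs0.le (min_le_left _ _)
  have hX : U * R * Uᴴ ∈ Matrix.unitaryGroup (Fin m) 𝕜 :=
    mul_mem (mul_mem h.1 hRu) (Unitary.star_mem h.1)
  set A' : leftDomain 𝕜 m n p := ⟨U * R * Uᴴ * A.1, unitary_mul_mem_leftDomain hX A.2⟩ with hA'
  have hdist : ‖A.1 - A'.1‖ ≤ D * s := by
    have e : A'.1 - A.1 = U * ((R - 1) * (Uᴴ * A.1)) := by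
      rw [Matrix.sub_mul, Matrix.mul_sub, Matrix.one_mul, ← Matrix.mul_assoc U Uᴴ, hU',
        Matrix.one_mul, hA']
      simp only [Matrix.mul_assoc]
    have hUH : Uᴴᴴ * Uᴴ = 1 := by rwa [Matrix.conjTranspose_conjTranspose]
    rw [norm_sub_rev, e, frobenius_norm_isometry_mul hU]
    refine (Matrix.frobenius_norm_mul _ _).trans ?_
    rw [frobenius_norm_isometry_mul hUH]
    have := mul_le_mul_of_nonneg_right hR1 (norm_nonneg A.1)
    rw [hD]
    nlinarith
  have hgr : s ≤ grDist .chordal (leftMap A) (leftMap A') := by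
    refine le_of_sq_le_sq ?_ (grDist_nonneg _ _ _)
    have hW : Uᴴ * (U * R * Uᴴ * U) = R := by
      rw [Matrix.mul_assoc (U * R), hU, Matrix.mul_one, ← Matrix.mul_assoc, hU, Matrix.one_mul]
    rw [chordal_leftMap_sq A A' h (h.unitary_mul hX), hW]
    calc s ^ 2 = ‖R j i‖ ^ 2 := by rw [hRs, RCLike.norm_ofReal, sq_abs]
      _ ≤ ∑ l ∈ p, ‖R j l‖ ^ 2 :=
        Finset.single_le_sum (f := fun l => ‖R j l‖ ^ 2) (fun _ _ => by positivity) hi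
      _ ≤ _ := Finset.single_le_sum (f := fun k => ∑ l ∈ p, ‖R k l‖ ^ 2)
        (fun _ _ => Finset.sum_nonneg fun _ _ => by positivity) (Finset.mem_compl.2 hj)
  refine ⟨A', ?_, ?_, ?_⟩
  · refine norm_pos_iff.2 (sub_ne_zero.2 fun e => ?_)
    rw [← Subtype.ext e, grDist_leftMap_self] at hgr
    exact hs0.not_ge hgr
  · refine hdist.trans ?_
    rw [← le_div_iff₀' hD0]
    exact min_le_right _ _
  · rw [one_div, inv_mul_le_iff₀ hD0]
    exact hdist.trans (mul_le_mul_of_nonneg_left hgr hD0.le)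

end Positivity

/-! ### The two constant cases -/

section Constant

variable {𝕜 : Type*} [RCLike 𝕜] {m n : ℕ} {p : Finset (Fin m)}

theorem leftDomain_eq_univ (hp : p = ∅ ∨ p = Finset.univ) : leftDomain 𝕜 m n p = Set.univ := by
  refine Set.eq_univ_of_forall fun A => ?_
  obtain ⟨U, V, h⟩ := exists_isFullSVD A
  refine ⟨U, V, h, ?_⟩
  rcases hp with rfl | rfl
  · exact ⟨∅, Set.empty_subset _, by simp [colSpan]⟩
  · refine ⟨Set.range (sv A), subset_rfl, ?_⟩
    have htop : colSpan U Finset.univ = ⊤ := by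
      refine eq_top_iff.2 fun v _ => ?_
      have hv : v = ∑ i, (Uᴴ *ᵥ v) i • Uᵀ i := by
        have h1 : U *ᵥ (Uᴴ *ᵥ v) = v := by
          have hU : U * Uᴴ = 1 := Matrix.mem_unitaryGroup_iff.1 h.1
          rw [Matrix.mulVec_mulVec, hU, Matrix.one_mulVec]
        conv_lhs => rw [← h1]
        ext k
        simp only [Matrix.mulVec, dotProduct, Finset.sum_apply, Pi.smul_apply, smul_eq_mul,
          Matrix.transpose_apply]
        exact Finset.sum_congr rfl fun i _ => mul_comm _ _
      rw [hv]
      exact Submodule.sum_mem _ fun i _ =>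
        Submodule.smul_mem _ _ (Submodule.subset_span ⟨i, by simp, rfl⟩)
    refine le_antisymm (Submodule.span_le.2 ?_) (by rw [htop]; exact le_top)
    rintro _ ⟨i, _, rfl⟩
    exact (le_iSup₂ (f := fun s (_ : s ∈ Set.range (sv A)) => leftSingularSpace A s) (sv A i)
      ⟨i, rfl⟩) (h.mem i)

theorem grDist_leftMap_eq_zero (hp : p = ∅ ∨ p = Finset.univ) (t : GrDist)
    (A A' : leftDomain 𝕜 m n p) : grDist t (leftMap A) (leftMap A') = 0 := by
  refine grDist_eq_zero_of_chordal_eq_zero (pow_eq_zero_iff two_ne_zero |>.1 ?_) t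
  obtain ⟨U, V, h⟩ := exists_isFullSVD A.1
  obtain ⟨U', V', h'⟩ := exists_isFullSVD A'.1
  rw [chordal_leftMap_sq A A' h h']
  rcases hp with rfl | rfl <;> simp

theorem exists_seq_tendsto_of_leftDomain_eq_univ (hm : 0 < m) (hn : 0 < n)
    (h : leftDomain 𝕜 m n p = Set.univ) (A : leftDomain 𝕜 m n p) :
    ∃ B : ℕ → leftDomain 𝕜 m n p, (∀ k, B k ≠ A) ∧ Tendsto B atTop (𝓝 A) := by
  let E : Matrix (Fin m) (Fin n) 𝕜 := Matrix.of fun _ _ => 1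
  have hE : E ≠ 0 := fun e => one_ne_zero (congrFun (congrFun e ⟨0, hm⟩) ⟨0, hn⟩)
  refine ⟨fun k => ⟨A.1 + (((1 / ((k : ℝ) + 1) : ℝ)) : 𝕜) • E, Set.eq_univ_iff_forall.1 h _⟩,
    fun k e => ?_, ?_⟩
  · have h1 := congrArg Subtype.val e
    simp only [add_eq_left, smul_eq_zero, hE, or_false] at h1
    have h2 : (0 : ℝ) < 1 / ((k : ℝ) + 1) := Nat.one_div_pos_of_nat
    exact h2.ne' (by exact_mod_cast h1)
  · refine tendsto_subtype_rng.2 ?_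
    have h1 : Tendsto (fun k : ℕ => ((1 / ((k : ℝ) + 1) : ℝ) : 𝕜)) atTop (𝓝 ((0 : ℝ) : 𝕜)) :=
      (RCLike.continuous_ofReal.tendsto 0).comp tendsto_one_div_add_atTop_nhds_zero_nat
    have h2 := (h1.smul_const E).const_add A.1
    simpa using h2

end Constant

theorem mainTheorem7 {𝕜 : Type*} [RCLike 𝕜] {m n : ℕ} (hm : 0 < m) (hn : 0 < n)
    (p : Finset (Fin m)) (A : leftDomain 𝕜 m n p) (t : GrDist) :
    condLeft t A ≠ ⊤ ∧ (∀ t' : GrDist, condLeft t' A = condLeft t A) ∧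
    (∃ δ : leftDomain 𝕜 m n p → ℝ, Tendsto δ (𝓝 A) (𝓝 0) ∧
      ∀ A' : leftDomain 𝕜 m n p,
        grDist t (leftMap A) (leftMap A') ≤
          (condLeft t A).toReal * ‖A.1 - A'.1‖ * (1 + δ A')) ∧
    (∃ B : ℕ → leftDomain 𝕜 m n p, (∀ k, B k ≠ A) ∧ Tendsto B atTop (𝓝 A) ∧
      ∃ η : ℕ → ℝ, Tendsto η atTop (𝓝 0) ∧
        ∀ k, grDist t (leftMap A) (leftMap (B k)) =
          (condLeft t A).toReal * ‖A.1 - (B k).1‖ * (1 + η k)) := by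
  have htop : condLeft t A ≠ ⊤ := condLeft_eq_chordal t A ▸ condLeft_chordal_ne_top A
  refine ⟨htop, fun t' => by rw [condLeft_eq_chordal t', condLeft_eq_chordal t], ?_⟩
  by_cases h0 : condLeft t A = 0
  · -- A vanishing condition number leaves no room for a first-order error, so the map is constant.
    have hp : p = ∅ ∨ p = Finset.univ := by
      by_contra! hcon
      obtain ⟨i, hi⟩ := hcon.1
      obtain ⟨j, hj⟩ : ∃ j, j ∉ p := by
        by_contra! h
        exact hcon.2 (Finset.eq_univ_of_forall h)
      exact condLeft_chordal_ne_zero A hi hj (condLeft_eq_chordal t A ▸ h0)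
    obtain ⟨B, hB, hlim⟩ := exists_seq_tendsto_of_leftDomain_eq_univ hm hn (leftDomain_eq_univ hp) A
    refine ⟨⟨fun _ => 0, tendsto_const_nhds, fun A' => ?_⟩, B, hB, hlim, fun _ => 0,
      tendsto_const_nhds, fun k => ?_⟩
    · simp [grDist_leftMap_eq_zero hp, h0]
    · simp [grDist_leftMap_eq_zero hp, h0]
  · have hd : ∀ A' : leftDomain 𝕜 m n p, ‖A.1 - A'.1‖ = dist A A' := fun A' => by
      rw [Subtype.dist_eq, dist_eq_norm]
    exact ⟨exists_bound_of_riceCond hd h0 htop (grDist_leftMap_self t A).le,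
      exists_sharp_of_riceCond hd h0 htop⟩
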